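/- Let $k$ be a field and $\mathfrak a$ a $k$-linear category with composition $m$. For a $k$-linear category let $Z^2\mathbf C(\mathfrak a)$ be the space of Hochschild 2-cocycles (bilinear $\phi=(\phi:\mathfrak a(B,C)\times\mathfrak a(A,B)\to\mathfrak a(A,C))$ with $\phi(f,g)h-\phi(f,gh)+\phi(fg,h)-f\phi(g,h)=0$), $HH^2(\mathfrak a)$ its quotient by the coboundaries, and for $\phi\in Z^2\mathbf C(\mathfrak a)$ let $\mathfrak a_\phi[\epsilon]=(k[\epsilon]\otimes\mathfrak a,\,m+\phi\epsilon)$ be the corresponding linear deformation ($\epsilon^2=0$). A *precomplex* over $\mathfrak a$ is a $\mathbb Z$-graded object $C$ with a degree $1$ graded endomorphism $\delta_C$. Precomplexes form a cdg category $\mathsf{PCom}(\mathfrak a)$ with $\mathsf{PCom}(\mathfrak a)(C,D)^n=\prod_i\mathfrak a(C^i,D^{i+n})$, the evident composition, $d(f)=\delta f-(-1)^{|f|}f\delta$ and curvature $c_C=-\delta_C^2$; $\mathsf{Com}^+(\mathfrak a)\subset\mathsf{PCom}(\mathfrak a)$ is the full dg subcategory of bounded below complexes. Put $\mathrm{embr}_\delta(\phi)=\phi+\phi\{\delta\}+\phi\{\delta,\delta\}$,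 a Hochschild 2-cocycle of $\mathsf{PCom}(\mathfrak a)$, where $\phi\{\delta\}(f)=\phi(\delta,f)-(-1)^{|f|}\phi(f,\delta)$ and $\phi\{\delta,\delta\}=-\phi(\delta,\delta)$. A *(first order) cdg, resp. dg, deformation* of a cdg, resp. dg, category $(\mathfrak b,\mu)$ is a $k[\epsilon]$-linear cdg, resp. dg, structure on a quiver identified with $k[\epsilon]\otimes_k\mathfrak b$ (same objects) reducing to $\mu$ modulo $\epsilon$. An *isomorphism* of deformations is an $A_{[0,\infty[}$-isomorphism with fixed objects (components $F_n:(\Sigma-)^{\otimes n}\to\Sigma-$, $n\ge 0$, with $F_0$ allowed to be nonzero) that reduces to the identity modulo $\epsilon$. A *partial* dg deformation of $\mathfrak b$ is a dg deformation of a full subcategory of $\mathfrak b$; a *morphism* of partial deformations is an isomorphism of deformations onto a full subcategory; a partial deformation is *maximal* if every morphism out of it is an isomorphism. $\mathrm{Sk}$ denotes isomorphism classes, and $\text{dg-pDef}$, $\text{dg-mpDef}$ the partial, resp. maximal partial, dg deformations. Let $R(\phi)$ be the cdg deformation $(k[\epsilon]\otimes\mathsf{PCom}(\mathfrak a),\,\mu+\mathrm{embr}_\delta(\phi)\epsilon)$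 of $(\mathsf{PCom}(\mathfrak a),\mu)$. Let $\mathsf{Com}^+(\mathfrak a)_{\phi-\infty}\subset\mathsf{Com}^+(\mathfrak a)$ be the full subcategory of those $C$ for which the class of $-\phi(\delta_C,\delta_C)$ in $H^2(\mathsf{Com}^+(\mathfrak a)(C,C))$ is zero. Let $\rho':HH^2(\mathfrak a)\to\mathrm{Sk}(\text{dg-pDef}_{\mathsf{Com}^+(\mathfrak a)}(k[\epsilon]))$ send $[\phi]$ to the class of the dg deformation of $\mathsf{Com}^+(\mathfrak a)_{\phi-\infty}$ given by $\mathrm{embr}_\delta(\phi)+d_{\mathrm{Hoch}}(h)$, where $h=(h_C)_C$ with $h_C\in\mathsf{Com}^+(\mathfrak a)(C,C)^1$ is any choice making the arity $0$ part of this cocycle zero. **Theorem.** Let $\phi\in Z^2\mathbf C(\mathfrak a)$. 1. $R(\phi)$ coincides, under the canonical identification of quivers (hence is isomorphic as a cdg deformation), with the full subcategory of $\mathsf{PCom}(\mathfrak a_\phi[\epsilon])$ on the trivial precomplexes $k[\epsilon]\otimes_kC$, $C\in\mathsf{PCom}(\mathfrak a)$. 2. For every collection $\Gamma=\{\bar C\}_{C\in\mathsf{PCom}(\mathfrak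 a)}$ of precomplexes over $\mathfrak a_\phi[\epsilon]$ with $k\otimes_{k[\epsilon]}\bar C=C$, the full subcategory of $\mathsf{PCom}(\mathfrak a_\phi[\epsilon])$ spanned by $\Gamma$ is a cdg deformation of $\mathsf{PCom}(\mathfrak a)$ isomorphic to $R(\phi)$. 3. For every collection $\Gamma=\{\bar C\}_{C\in\mathsf{Com}^+(\mathfrak a)_{\phi-\infty}}$ of complexes over $\mathfrak a_\phi[\epsilon]$ with $k\otimes_{k[\epsilon]}\bar C=C$, the full subcategory of $\mathsf{Com}^+(\mathfrak a_\phi[\epsilon])$ spanned by $\Gamma$ is a maximal partial dg deformation of $\mathsf{Com}^+(\mathfrak a)$ representing $\rho'([\phi])$. Consequently $\rho'$ factors through a map $\rho:HH^2(\mathfrak a)\to\mathrm{Sk}(\text{dg-mpDef}_{\mathsf{Com}^+(\mathfrak a)}(k[\epsilon]))$. If $\mathfrak a$ has a zero object, so that $\mathfrak a\subset\mathsf{Com}^+(\mathfrak a)$ as the complexes concentrated in degree $0$, then $\rho$ is injective, and its image consists of the classes of those maximal partial dg deformations that are dg deformations of some full subcategory $\mathfrak a'$ with $\mathfrak a\subset\mathfrak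 a'\subset\mathsf{Com}^+(\mathfrak a)$. -/

import Mathlib

open CategoryTheory

universe w v u u'

namespace LowenDef

/-! ## First order extension of modules -/

/-- The `k[ε]`-module `k[ε] ⊗ M = M ⊕ Mε`; the pair `(x, y)` stands for `x + yε`. -/
@[ext]
structure Eps (M : Type v) where
  re : M
  im : M

namespace Eps

/-- `x + yε` as a pair, used to transfer the additive structure. -/
def toProd {M : Type v} (x : Eps M) : M × M := (x.re, x.im)

theorem toProd_injective {M : Type v} : Function.Injective (toProd (M := M)) := by
  intro x y h
  simp only [toProd, Prod.mk.injEq] at h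
  exact Eps.ext h.1 h.2

variable {k : Type w} [CommRing k] {M : Type v} [AddCommGroup M]

instance : Zero (Eps M) := ⟨⟨0, 0⟩⟩
instance : Add (Eps M) := ⟨fun x y => ⟨x.re + y.re, x.im + y.im⟩⟩
instance : Neg (Eps M) := ⟨fun x => ⟨-x.re, -x.im⟩⟩
instance : Sub (Eps M) := ⟨fun x y => ⟨x.re - y.re, x.im - y.im⟩⟩
instance : SMul ℕ (Eps M) := ⟨fun n x => ⟨n • x.re, n • x.im⟩⟩
instance : SMul ℤ (Eps M) := ⟨fun n x => ⟨n • x.re, n • x.im⟩⟩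

instance : AddCommGroup (Eps M) :=
  toProd_injective.addCommGroup toProd rfl (fun _ _ => rfl) (fun _ => rfl) (fun _ _ => rfl)
    (fun _ _ => rfl) (fun _ _ => rfl)

@[simp] theorem re_zero : (0 : Eps M).re = 0 := rfl
@[simp] theorem im_zero : (0 : Eps M).im = 0 := rfl
@[simp] theorem re_add (x y : Eps M) : (x + y).re = x.re + y.re := rfl
@[simp] theorem im_add (x y : Eps M) : (x + y).im = x.im + y.im := rfl
@[simp] theorem re_neg (x : Eps M) : (-x).re = -x.re := rfl
@[simp] theorem im_neg (x : Eps M) : (-x).im = -x.im := rfl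
@[simp] theorem re_sub (x y : Eps M) : (x - y).re = x.re - y.re := rfl
@[simp] theorem im_sub (x y : Eps M) : (x - y).im = x.im - y.im := rfl
@[simp] theorem re_zsmul (n : ℤ) (x : Eps M) : (n • x).re = n • x.re := rfl
@[simp] theorem im_zsmul (n : ℤ) (x : Eps M) : (n • x).im = n • x.im := rfl
@[simp] theorem re_usmul (n : ℤˣ) (x : Eps M) : (n • x).re = n • x.re := rfl
@[simp] theorem im_usmul (n : ℤˣ) (x : Eps M) : (n • x).im = n • x.im := rfl

variable [Module k M]

/-- `(r + sε)(x + yε) = rx + (ry + sx)ε`. -/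
instance : SMul (DualNumber k) (Eps M) :=
  ⟨fun r x => ⟨r.fst • x.re, r.fst • x.im + r.snd • x.re⟩⟩

@[simp] theorem re_smul (r : DualNumber k) (x : Eps M) : (r • x).re = r.fst • x.re := rfl
@[simp] theorem im_smul (r : DualNumber k) (x : Eps M) :
    (r • x).im = r.fst • x.im + r.snd • x.re := rfl

instance : Module (DualNumber k) (Eps M) where
  one_smul x := by ext <;> simp
  mul_smul r s x := by
    ext
    · simp [mul_smul]
    · simp only [re_smul, im_smul, TrivSqZeroExt.fst_mul, TrivSqZeroExt.snd_mul, smul_eq_mul,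
        MulOpposite.smul_eq_mul_unop, MulOpposite.unop_op, add_smul, mul_smul, smul_add]
      rw [add_assoc]
  smul_zero r := by ext <;> simp
  smul_add r x y := by
    ext
    · simp
    · simp only [im_smul, im_add, re_add, smul_add]; abel
  add_smul r s x := by
    ext
    · simp [add_smul]
    · simp only [im_smul, im_add, TrivSqZeroExt.fst_add, TrivSqZeroExt.snd_add, add_smul]; abel
  zero_smul x := by ext <;> simp

end Eps

/-! ## Graded quivers and cdg structures -/

/-- A graded `R`-quiver with set of objects `T`. -/
structure GrQuiver (R : Type w) [CommRing R] (T : Type u) where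
  Hom : T → T → ℤ → Type v
  [acg : ∀ A B n, AddCommGroup (Hom A B n)]
  [mod : ∀ A B n, Module R (Hom A B n)]

attribute [instance] GrQuiver.acg GrQuiver.mod

section Quivers

variable {R : Type w} [CommRing R] {T : Type u}

/-- The quiver with objects `T'` induced along a map `o` on objects. For `o` the inclusion of a
subset this is the full subquiver on that subset. -/
def GrQuiver.pull {T' : Type*} (Q : GrQuiver.{w, v} R T) (o : T' → T) : GrQuiver.{w, v} R T' where
  Hom A B n := Q.Hom (o A) (o B) n

/-- A Hochschild cochain of Hochschild degree `2` on a graded quiver with components in arity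
at most `2`: a degree `0` component `m` of arity `2`, a degree `1` component `d` of arity `1` and a
degree `2` component `c` of arity `0`. Here `m f g` is written for `f : B → C` and `g : A → B`. -/
structure Cochain2 (Q : GrQuiver.{w, v} R T) where
  m : ∀ {A B C : T} {p q n : ℤ}, p + q = n →
    (Q.Hom B C p →ₗ[R] Q.Hom A B q →ₗ[R] Q.Hom A C n)
  d : ∀ {A B : T} {p q : ℤ}, p + 1 = q → (Q.Hom A B p →ₗ[R] Q.Hom A B q)
  c : ∀ A : T, Q.Hom A A 2

/-- The cochain `(m, d, c)` is a cdg structure. -/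
structure Cochain2.IsCDG {Q : GrQuiver.{w, v} R T} (μ : Cochain2 Q) : Prop where
  d_c : ∀ A : T, μ.d (show (2 : ℤ) + 1 = 3 by norm_num) (μ.c A) = 0
  d_d : ∀ {A B : T} {p q r : ℤ} (h : p + 1 = q) (h' : q + 1 = r) (f : Q.Hom A B p),
    μ.d h' (μ.d h f) =
      -(μ.m (show 2 + p = r by omega) (μ.c B) f - μ.m (show p + 2 = r by omega) f (μ.c A))
  leibniz : ∀ {A B C : T} {p q n p' q' n' : ℤ} (h : p + q = n) (hp : p + 1 = p') (hq : q + 1 = q')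
    (hn : n + 1 = n') (f : Q.Hom B C p) (g : Q.Hom A B q),
    μ.d hn (μ.m h f g) =
      μ.m (show p' + q = n' by omega) (μ.d hp f) g +
        p.negOnePow • μ.m (show p + q' = n' by omega) f (μ.d hq g)
  assoc : ∀ {A B C D : T} {p q r pq qr n : ℤ} (hpq : p + q = pq) (hqr : q + r = qr)
    (h : p + q + r = n) (f : Q.Hom C D p) (g : Q.Hom B C q) (e : Q.Hom A B r),
    μ.m (show pq + r = n by omega) (μ.m hpq f g) e =
      μ.m (show p + qr = n by omega) f (μ.m hqr g e)

/-- Restriction of a cochain along a map on objects. -/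
def Cochain2.pull {T' : Type*} {Q : GrQuiver.{w, v} R T} (μ : Cochain2 Q) (o : T' → T) :
    Cochain2 (Q.pull o) where
  m h := μ.m h
  d h := μ.d h
  c A := μ.c (o A)

instance {Q : GrQuiver.{w, v} R T} : Add (Cochain2 Q) :=
  ⟨fun μ ν => ⟨fun h => μ.m h + ν.m h, fun h => μ.d h + ν.d h, fun A => μ.c A + ν.c A⟩⟩

/-- For a cdg structure `μ`, the Hochschild coboundary of a cochain `h` of arity `0` and degree `1`,
that is `h ∈ ∏_A Q(A,A)^1`. Its component of arity `1` is `f ↦ h f - (-1)^|f| f h` and its component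
of arity `0` is `-d(h)`. -/
def Cochain2.coboundaryZero {Q : GrQuiver.{w, v} R T} (μ : Cochain2 Q) (h : ∀ A : T, Q.Hom A A 1) :
    Cochain2 Q where
  m _ := 0
  d {A B p q} hpq :=
    μ.m (show 1 + p = q by omega) (h B) - p.negOnePow • (μ.m hpq).flip (h A)
  c A := -μ.d (show (1 : ℤ) + 1 = 2 by norm_num) (h A)

theorem Cochain2.IsCDG.pull {T' : Type*} {Q : GrQuiver.{w, v} R T} {μ : Cochain2 Q}
    (hμ : μ.IsCDG) (o : T' → T) : (μ.pull o).IsCDG where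
  d_c A := hμ.d_c (o A)
  d_d h h' f := hμ.d_d h h' f
  leibniz h hp hq hn f g := hμ.leibniz h hp hq hn f g
  assoc hpq hqr h f g e := hμ.assoc hpq hqr h f g e

/-- A cdg structure may be transported along linear isomorphisms of the graded modules of
morphisms. -/
theorem Cochain2.IsCDG.transfer {Q Q' : GrQuiver.{w, v} R T} {μ : Cochain2 Q} {μ' : Cochain2 Q'}
    (hμ : μ.IsCDG) (e : ∀ (A B : T) (n : ℤ), Q.Hom A B n ≃ₗ[R] Q'.Hom A B n)
    (em : ∀ {A B C : T} {p q n : ℤ} (h : p + q = n) (f : Q.Hom B C p) (g : Q.Hom A B q),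
      e A C n (μ.m h f g) = μ'.m h (e B C p f) (e A B q g))
    (ed : ∀ {A B : T} {p q : ℤ} (h : p + 1 = q) (f : Q.Hom A B p),
      e A B q (μ.d h f) = μ'.d h (e A B p f))
    (ec : ∀ A : T, e A A 2 (μ.c A) = μ'.c A) : μ'.IsCDG where
  d_c A := by rw [← ec, ← ed, hμ.d_c, map_zero]
  d_d {A B p q r} h h' f := by
    obtain ⟨f, rfl⟩ := (e _ _ _).surjective f
    rw [← ed, ← ed, hμ.d_d h h', ← ec, ← ec, ← em, ← em, map_neg, map_sub]
  leibniz h hp hq hn f g := by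
    obtain ⟨f, rfl⟩ := (e _ _ _).surjective f
    obtain ⟨g, rfl⟩ := (e _ _ _).surjective g
    rw [← em, ← ed, hμ.leibniz h hp hq hn, ← ed, ← ed, ← em, ← em, map_add, Units.smul_def,
      map_zsmul, Units.smul_def]
  assoc hpq hqr h f g i := by
    obtain ⟨f, rfl⟩ := (e _ _ _).surjective f
    obtain ⟨g, rfl⟩ := (e _ _ _).surjective g
    obtain ⟨i, rfl⟩ := (e _ _ _).surjective i
    rw [← em, ← em, hμ.assoc hpq hqr h, ← em, ← em]

/-! ## Morphisms with fixed objects -/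

/-- Composable sequences `(f_n, …, f_1)` of homogeneous elements, from the source of `f_1` to the
target of `f_n`. -/
inductive Path (Q : GrQuiver.{w, v} R T) : T → T → Type (max u v)
  | nil (A : T) : Path Q A A
  | cons {A B C : T} {n : ℤ} (f : Q.Hom B C n) (p : Path Q A B) : Path Q A C

namespace Path

variable {Q : GrQuiver.{w, v} R T}

/-- Concatenation. -/
def append {A B : T} : ∀ {C : T}, Path Q B C → Path Q A B → Path Q A C
  | _, nil _, q => q
  | _, cons f p, q => cons f (append p q)

/-- The degree of `σf_n ⊗ ⋯ ⊗ σf_1` in `(Σ Q)^{⊗ n}`, namely `∑ (|f_i| - 1)`. -/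
def sdeg : ∀ {A B : T}, Path Q A B → ℤ
  | _, _, nil _ => 0
  | _, _, cons (n := n) _ p => (n - 1) + sdeg p

/-- The sum of `Φ (f_n, …, f_{i+1}) (f_i, …, f_1)` over `0 ≤ i ≤ n`. -/
def sumSplit {M : Type v} [AddCommGroup M] {A : T} : ∀ {C : T}, Path Q A C →
    (∀ B : T, Path Q B C → Path Q A B → M) → M
  | _, nil A, Φ => Φ A (nil A) (nil A)
  | C, cons f p, Φ => Φ C (nil C) (cons f p) + sumSplit p (fun B l r => Φ B (cons f l) r)

/-- Evaluation of `Φ` on `m (f, g_1) ⊗ g_2 ⊗ ⋯` with the sign coming from the shift; zero if there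
is no first element `g_1`. -/
def contractFirst (μ : Cochain2 Q) {M : Type v} [AddCommGroup M] {B C : T} {n : ℤ}
    (f : Q.Hom B C n) : ∀ {A : T}, Path Q A B → (Path Q A C → M) → M
  | _, nil _, _ => 0
  | _, cons g p, Φ => n.negOnePow • Φ (cons (μ.m rfl f g) p)

/-- The evaluation of `Φ` on `∑ (1 ⊗ ⋯ ⊗ b ⊗ ⋯ ⊗ 1)(σf_n, …, σf_1)`, where
`b_0 = σc`, `b_1(σf) = -σ d(f)` and `b_2(σf, σg) = (-1)^|f| σ m(f, g)` are the coefficients of the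
degree `1` element `b` corresponding to `μ = (m, d, c)`, and the Koszul sign rule is used. -/
def sumInsert (μ : Cochain2 Q) {M : Type v} [AddCommGroup M] {A : T} : ∀ {C : T}, Path Q A C →
    (Path Q A C → M) → M
  | _, nil A, Φ => Φ (cons (μ.c A) (nil A))
  | C, cons (n := n) f p, Φ =>
      Φ (cons (μ.c C) (cons f p)) - Φ (cons (μ.d rfl f) p) + contractFirst μ f p Φ +
        (n - 1).negOnePow • sumInsert μ p (fun q => Φ (cons f q))

end Path

/-- A morphism of `A_{[0,∞[}`-categories with fixed objects between two cdg categories. The value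
`F (f_n, …, f_1)` is `σ^{-1} F_n(σf_n, …, σf_1)`, where `F_n : (ΣQ)^{⊗ n} → ΣQ'` has degree `0`;
`F p e` is its component of degree `e`, which is zero for `e ≠ ∑ (|f_i| - 1) + 1`.
The last two fields express `b' ∘ F = F ∘ b`, for the coefficients `b`, `b'` corresponding to
`μ`, `μ'`, on the empty sequences and on the nonempty sequences, respectively. -/
structure AMor {Q Q' : GrQuiver.{w, v} R T} (μ : Cochain2 Q) (μ' : Cochain2 Q') where
  F : ∀ {A B : T}, Path Q A B → ∀ e : ℤ, Q'.Hom A B e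
  F_deg : ∀ {A B : T} (p : Path Q A B) (e : ℤ), e ≠ p.sdeg + 1 → F p e = 0
  F_add : ∀ {A B C D : T} {n : ℤ} (l : Path Q C D) (f g : Q.Hom B C n) (r : Path Q A B) (e : ℤ),
    F (l.append (.cons (f + g) r)) e =
      F (l.append (.cons f r)) e + F (l.append (.cons g r)) e
  F_smul : ∀ {A B C D : T} {n : ℤ} (l : Path Q C D) (x : R) (f : Q.Hom B C n) (r : Path Q A B)
    (e : ℤ), F (l.append (.cons (x • f) r)) e = x • F (l.append (.cons f r)) e
  eq_nil : ∀ A : T,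
    μ'.c A - μ'.d (show (1 : ℤ) + 1 = 2 by norm_num) (F (.nil A) 1) -
        μ'.m (show (1 : ℤ) + 1 = 2 by norm_num) (F (.nil A) 1) (F (.nil A) 1) =
      F (.cons (μ.c A) (.nil A)) 2
  eq_cons : ∀ {A B C : T} {n : ℤ} (f : Q.Hom B C n) (p : Path Q A B) (i e : ℤ)
    (_ : (Path.cons f p).sdeg + 1 = i) (he : i + 1 = e),
    -μ'.d he (F (.cons f p) i) +
        (Path.cons f p).sumSplit (fun _ l r => (l.sdeg + 1).negOnePow •
          μ'.m (add_sub_cancel (l.sdeg + 1) e) (F l (l.sdeg + 1)) (F r (e - (l.sdeg + 1)))) =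
      (Path.cons f p).sumInsert μ (fun q => F q e)

end Quivers

/-! ## First order deformations -/

section Deformations

variable {k : Type w} [CommRing k] {T : Type u}

/-- The `k[ε]`-quiver `k[ε] ⊗ Q`. -/
def GrQuiver.eps (Q : GrQuiver.{w, v} k T) : GrQuiver.{w, v} (DualNumber k) T where
  Hom A B n := Eps (Q.Hom A B n)

/-- The `k[ε]`-linear extension `x + yε ↦ f(x) + (f(y) + g(x))ε` of `f + gε`. -/
def epsLin {M N : Type v} [AddCommGroup M] [AddCommGroup N] [Module k M] [Module k N]
    (f g : M →ₗ[k] N) : Eps M →ₗ[DualNumber k] Eps N where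
  toFun x := ⟨f x.re, f x.im + g x.re⟩
  map_add' x y := by ext <;> simp [add_add_add_comm]
  map_smul' r x := by
    ext
    · simp
    · simp only [Eps.re_smul, Eps.im_smul, map_add, map_smul, RingHom.id_apply, smul_add]
      abel

/-- The `k[ε]`-bilinear extension of `f + gε`. -/
def epsBilin {M N P : Type v} [AddCommGroup M] [AddCommGroup N] [AddCommGroup P]
    [Module k M] [Module k N] [Module k P] (f g : M →ₗ[k] N →ₗ[k] P) :
    Eps M →ₗ[DualNumber k] Eps N →ₗ[DualNumber k] Eps P :=
  LinearMap.mk₂ (DualNumber k)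
    (fun x y => ⟨f x.re y.re, f x.re y.im + f x.im y.re + g x.re y.re⟩)
    (fun x x' y => by
      ext
      · simp
      · simp only [Eps.re_add, Eps.im_add, map_add, LinearMap.add_apply]; abel)
    (fun r x y => by
      ext
      · simp
      · simp only [Eps.re_smul, Eps.im_smul, map_add, map_smul, LinearMap.add_apply,
          LinearMap.smul_apply, smul_add]; abel)
    (fun x y y' => by
      ext
      · simp
      · simp only [Eps.re_add, Eps.im_add, map_add]; abel)
    (fun r x y => by
      ext
      · simp
      · simp only [Eps.re_smul, Eps.im_smul, map_add, map_smul, smul_add]; abel)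

/-- The cochain `μ + ψε` on `k[ε] ⊗ Q`. -/
def Cochain2.eps {Q : GrQuiver.{w, v} k T} (μ ψ : Cochain2 Q) : Cochain2 Q.eps where
  m h := epsBilin (μ.m h) (ψ.m h)
  d h := epsLin (μ.d h) (ψ.d h)
  c A := ⟨μ.c A, ψ.c A⟩

/-- A first order cdg deformation of the cdg category `(Q, μ)`: a `k[ε]`-linear cdg category
with the same objects on a quiver identified with `k[ε] ⊗ Q`, whose reduction modulo `ε` is `μ`. -/
structure Deformation {Q : GrQuiver.{w, v} k T} (μ : Cochain2 Q) where
  quiv : GrQuiver.{w, v} (DualNumber k) T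
  e : ∀ (A B : T) (n : ℤ), quiv.Hom A B n ≃ₗ[DualNumber k] Eps (Q.Hom A B n)
  str : Cochain2 quiv
  isCDG : str.IsCDG
  red_m : ∀ {A B C : T} {p q n : ℤ} (h : p + q = n) (f : quiv.Hom B C p) (g : quiv.Hom A B q),
    (e A C n (str.m h f g)).re = μ.m h (e B C p f).re (e A B q g).re
  red_d : ∀ {A B : T} {p q : ℤ} (h : p + 1 = q) (f : quiv.Hom A B p),
    (e A B q (str.d h f)).re = μ.d h (e A B p f).re
  red_c : ∀ A : T, (e A A 2 (str.c A)).re = μ.c A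

namespace Deformation

variable {Q : GrQuiver.{w, v} k T} {μ : Cochain2 Q}

/-- A cdg deformation is a dg deformation if its curvature vanishes. -/
def IsDG (D : Deformation μ) : Prop := ∀ A : T, D.str.c A = 0

/-- Two deformations are isomorphic if there is an `A_{[0,∞[}`-morphism `F` between them whose
reduction modulo `ε` is the identity morphism (the arity `1` part of which is the identity and the
other parts of which are zero). As `ε² = 0`, such an `F = 1 + hε` is invertible with inverse
`1 - hε`. -/
def Iso (D D' : Deformation μ) : Prop :=
  ∃ F : AMor D.str D'.str,
    (∀ (A : T) (i : ℤ), (D'.e A A i (F.F (.nil A) i)).re = 0) ∧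
    (∀ {A B : T} {n : ℤ} (f : D.quiv.Hom A B n),
      (D'.e A B n (F.F (.cons f (.nil A)) n)).re = (D.e A B n f).re) ∧
    (∀ {A B C E : T} {n n' : ℤ} (f : D.quiv.Hom C E n) (g : D.quiv.Hom B C n')
      (p : Path D.quiv A B) (i : ℤ), (D'.e A E i (F.F (.cons f (.cons g p)) i)).re = 0)

/-- Two deformations coincide if their structures are equal once both quivers are identified with
`k[ε] ⊗ Q`. -/
def Coincide (D D' : Deformation μ) : Prop :=
  (∀ {A B C : T} {p q n : ℤ} (h : p + q = n) (f : Eps (Q.Hom B C p)) (g : Eps (Q.Hom A B q)),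
    D.e A C n (D.str.m h ((D.e B C p).symm f) ((D.e A B q).symm g)) =
      D'.e A C n (D'.str.m h ((D'.e B C p).symm f) ((D'.e A B q).symm g))) ∧
  (∀ {A B : T} {p q : ℤ} (h : p + 1 = q) (f : Eps (Q.Hom A B p)),
    D.e A B q (D.str.d h ((D.e A B p).symm f)) =
      D'.e A B q (D'.str.d h ((D'.e A B p).symm f))) ∧
  (∀ A : T, D.e A A 2 (D.str.c A) = D'.e A A 2 (D'.str.c A))

/-- The induced deformation along a map on objects. -/
def pull {T' : Type*} (D : Deformation μ) (o : T' → T) : Deformation (μ.pull o) where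
  quiv := D.quiv.pull o
  e A B n := D.e (o A) (o B) n
  str := D.str.pull o
  isCDG := D.isCDG.pull o
  red_m h f g := D.red_m h f g
  red_d h f := D.red_d h f
  red_c A := D.red_c (o A)

end Deformation

/-- A partial first order dg deformation of `(Q, μ)`: a first order dg deformation of the full
subcategory on a set `S` of objects. -/
structure PartialDG {Q : GrQuiver.{w, v} k T} (μ : Cochain2 Q) where
  S : Set T
  D : Deformation (μ.pull (Subtype.val : S → T))
  isDG : D.IsDG

namespace PartialDG

variable {Q : GrQuiver.{w, v} k T} {μ : Cochain2 Q}

/-- The full subcategory of a deformation of the full subcategory on `P.S`, on a smaller set of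
objects. -/
def restrict (P : PartialDG μ) {S : Set T} (h : S ⊆ P.S) :
    Deformation (μ.pull (Subtype.val : S → T)) :=
  P.D.pull (Set.inclusion h)

/-- There is a morphism `P → P'` of partial deformations: `P` is isomorphic, as a deformation, to a
full subcategory of `P'`. -/
def HasMor (P P' : PartialDG μ) : Prop :=
  ∃ h : P.S ⊆ P'.S, P.D.Iso (P'.restrict h)

/-- `P` and `P'` are isomorphic partial deformations: they are deformations of the same full
subcategory and as such isomorphic. -/
def Iso (P P' : PartialDG μ) : Prop :=
  ∃ h : P.S = P'.S, P.D.Iso (P'.restrict h.subset)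

/-- `P` is maximal if every morphism `P → P'` of partial deformations is an isomorphism; as the
morphisms are isomorphisms onto full subcategories, this says that `P'` has no more objects. -/
def IsMaximal (P : PartialDG μ) : Prop :=
  ∀ P' : PartialDG μ, P.HasMor P' → P'.S = P.S

variable (μ)

/-- Isomorphism classes of partial dg deformations. -/
def Sk : Type _ := Quot (PartialDG.Iso (μ := μ))

/-- Isomorphism classes of maximal partial dg deformations. -/
def SkMax : Type _ :=
  Quot (fun P P' : {P : PartialDG μ // P.IsMaximal} => PartialDG.Iso P.1 P'.1)

variable {μ}

/-- The isomorphism class of a partial dg deformation. -/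
def Sk.mk (P : PartialDG μ) : Sk μ := Quot.mk _ P

/-- The isomorphism class of a maximal partial dg deformation. -/
def SkMax.mk (P : PartialDG μ) (hP : P.IsMaximal) : SkMax μ := Quot.mk _ ⟨P, hP⟩

/-- The isomorphism class of a maximal partial dg deformation, as a partial dg deformation. -/
def SkMax.forget : SkMax μ → Sk μ := Quot.map Subtype.val (fun _ _ h => h)

end PartialDG

end Deformations

/-! ## Linear categories, Hochschild 2-cocycles and linear deformations -/

section Linear

variable (R : Type w) [CommRing R] (a : Type u) [Category.{v} a] [Preadditive a] [Linear R a]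

/-- Hochschild `1`-cochains of a linear category. -/
def C1 : Type (max u v) := ∀ A B : a, (A ⟶ B) →ₗ[R] (A ⟶ B)

/-- Hochschild `2`-cochains of a linear category; `φ A B C f g` is `φ(f, g)` for
`f : B → C` and `g : A → B`. -/
def C2 : Type (max u v) := ∀ A B C : a, (B ⟶ C) →ₗ[R] (A ⟶ B) →ₗ[R] (A ⟶ C)

instance : AddCommGroup (C1 R a) :=
  inferInstanceAs (AddCommGroup (∀ A B : a, (A ⟶ B) →ₗ[R] (A ⟶ B)))

instance : Module R (C1 R a) :=
  inferInstanceAs (Module R (∀ A B : a, (A ⟶ B) →ₗ[R] (A ⟶ B)))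

instance : AddCommGroup (C2 R a) :=
  inferInstanceAs (AddCommGroup (∀ A B C : a, (B ⟶ C) →ₗ[R] (A ⟶ B) →ₗ[R] (A ⟶ C)))

instance : Module R (C2 R a) :=
  inferInstanceAs (Module R (∀ A B C : a, (B ⟶ C) →ₗ[R] (A ⟶ B) →ₗ[R] (A ⟶ C)))

section

variable {R a}

theorem C2.ext {φ ψ : C2 R a}
    (h : ∀ (A B C : a) (f : B ⟶ C) (g : A ⟶ B), φ A B C f g = ψ A B C f g) : φ = ψ :=
  funext fun A => funext fun B => funext fun C => LinearMap.ext₂ (h A B C)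

@[simp] theorem C1.add_apply (h h' : C1 R a) (A B : a) (f : A ⟶ B) :
    (h + h') A B f = h A B f + h' A B f := rfl
@[simp] theorem C1.smul_apply (r : R) (h : C1 R a) (A B : a) (f : A ⟶ B) :
    (r • h) A B f = r • h A B f := rfl
@[simp] theorem C2.zero_apply (A B C : a) (f : B ⟶ C) (g : A ⟶ B) :
    (0 : C2 R a) A B C f g = 0 := rfl
@[simp] theorem C2.add_apply (φ ψ : C2 R a) (A B C : a) (f : B ⟶ C) (g : A ⟶ B) :
    (φ + ψ) A B C f g = φ A B C f g + ψ A B C f g := rfl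
@[simp] theorem C2.smul_apply (r : R) (φ : C2 R a) (A B C : a) (f : B ⟶ C) (g : A ⟶ B) :
    (r • φ) A B C f g = r • φ A B C f g := rfl

end

/-- The composition `m(f, g) = f g = g ≫ f` as a `2`-cochain. -/
def compC2 : C2 R a := fun A B C => (Linear.comp A B C).flip

variable {R a}

/-- A bilinear multiplication is associative. -/
def C2.IsAssoc (φ : C2 R a) : Prop :=
  ∀ {A B C D : a} (f : C ⟶ D) (g : B ⟶ C) (h : A ⟶ B),
    φ A B D (φ B C D f g) h = φ A C D f (φ A B C g h)

theorem compC2_isAssoc : (compC2 R a).IsAssoc := by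
  intro A B C D f g h
  simp [compC2, Linear.comp]

variable (R a)

variable {R a} in
/-- `(dh)(f, g) = h(f) g - h(f g) + f h(g)`. -/
def d1Fun (h : C1 R a) : C2 R a := fun A B C => LinearMap.mk₂ R
  (fun f g => g ≫ h B C f - h A C (g ≫ f) + h A B g ≫ f)
  (fun f f' g => by simp only [map_add, Preadditive.comp_add]; abel)
  (fun r f g => by simp [smul_sub, smul_add])
  (fun f g g' => by simp only [map_add, Preadditive.add_comp]; abel)
  (fun r f g => by simp [smul_sub, smul_add])

variable {R a} in
theorem d1Fun_apply (h : C1 R a) {A B C : a} (f : B ⟶ C) (g : A ⟶ B) :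
    d1Fun h A B C f g = g ≫ h B C f - h A C (g ≫ f) + h A B g ≫ f := rfl

/-- The Hochschild differential `C¹ → C²`. -/
def d1 : C1 R a →ₗ[R] C2 R a where
  toFun := d1Fun
  map_add' h h' := C2.ext fun A B C f g => by
    simp only [C2.add_apply, d1Fun_apply, C1.add_apply, Preadditive.comp_add,
      Preadditive.add_comp]
    abel
  map_smul' r h := C2.ext fun A B C f g => by
    simp only [C2.smul_apply, d1Fun_apply, C1.smul_apply, Linear.comp_smul,
      Linear.smul_comp, smul_sub, smul_add, RingHom.id_apply]

/-- Hochschild `2`-cocycles: `φ(f, g) h - φ(f, g h) + φ(f g, h) - f φ(g, h) = 0`. -/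
def Z2 : Submodule R (C2 R a) where
  carrier := {φ | ∀ {A B C D : a} (f : C ⟶ D) (g : B ⟶ C) (h : A ⟶ B),
    h ≫ φ B C D f g - φ A C D f (h ≫ g) + φ A B D (g ≫ f) h - φ A B C g h ≫ f = 0}
  add_mem' := by
    intro φ ψ hφ hψ A B C D f g h
    have h1 := hφ f g h
    have h2 := hψ f g h
    simp only [C2.add_apply, Preadditive.comp_add, Preadditive.add_comp]
    rw [← add_zero (0 : A ⟶ D)]
    nth_rewrite 1 [← h1]
    rw [← h2]
    abel
  zero_mem' := by intro A B C D f g h; simp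
  smul_mem' := by
    intro r φ hφ A B C D f g h
    have h1 := hφ f g h
    simp only [C2.smul_apply, Linear.comp_smul, Linear.smul_comp]
    rw [← smul_sub, ← smul_add, ← smul_sub, h1, smul_zero]

/-- The second Hochschild cohomology of a linear category. -/
abbrev HH2 : Type (max u v) := Z2 R a ⧸ (LinearMap.range (d1 R a)).submoduleOf (Z2 R a)

variable {R a}

/-- The class of a cocycle. -/
def HH2.mk (φ : Z2 R a) : HH2 R a := Submodule.Quotient.mk φ

theorem z2_eq (φ : Z2 R a) {A B C D : a} (f : C ⟶ D) (g : B ⟶ C) (h : A ⟶ B) :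
    h ≫ φ.1 B C D f g - φ.1 A C D f (h ≫ g) + φ.1 A B D (g ≫ f) h - φ.1 A B C g h ≫ f = 0 :=
  φ.2 f g h

/-- The linear deformation `a_φ[ε] = (k[ε] ⊗ a, m + φε)`: it has the objects of `a`. -/
def DefCat (_ : Z2 R a) : Type u := a

namespace DefCat

/-- The underlying object of `a`. -/
def base {φ : Z2 R a} (A : DefCat φ) : a := A

variable (φ : Z2 R a)

theorem unit_left {A B : a} (f : A ⟶ B) :
    φ.1 A B B (𝟙 B) f = f ≫ φ.1 B B B (𝟙 B) (𝟙 B) := by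
  have h := z2_eq φ (𝟙 B) (𝟙 B) f
  simp only [Category.comp_id] at h
  rw [sub_add_cancel, sub_eq_zero] at h
  exact h.symm

theorem unit_right {A B : a} (f : A ⟶ B) :
    φ.1 A A B f (𝟙 A) = φ.1 A A A (𝟙 A) (𝟙 A) ≫ f := by
  have h := z2_eq φ f (𝟙 A) (𝟙 A)
  simp only [Category.id_comp] at h
  rw [sub_self, zero_add, sub_eq_zero] at h
  exact h

/-- The composition is `m + φε`; the identity of `A` is `1 - φ(1, 1)ε`. -/
instance : Category.{v} (DefCat φ) where
  Hom A B := Eps (A.base ⟶ B.base)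
  id A := ⟨𝟙 A.base, -φ.1 A.base A.base A.base (𝟙 A.base) (𝟙 A.base)⟩
  comp {A B C} g f := ⟨g.re ≫ f.re, g.im ≫ f.re + g.re ≫ f.im + φ.1 A.base B.base C.base f.re g.re⟩
  id_comp {A B} f := by
    have := unit_right φ f.re
    ext <;> simp [this]
  comp_id {A B} f := by
    have := unit_left φ f.re
    ext <;> simp [this]
  assoc {A B C D} h g f := by
    ext
    · simp
    · have := z2_eq φ f.re g.re h.re
      simp only [Preadditive.add_comp, Preadditive.comp_add, Category.assoc]
      rw [← sub_eq_zero, ← neg_eq_zero, ← this]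
      abel

instance (A B : DefCat φ) : AddCommGroup (A ⟶ B) :=
  inferInstanceAs (AddCommGroup (Eps (A.base ⟶ B.base)))

instance (A B : DefCat φ) : Module (DualNumber R) (A ⟶ B) :=
  inferInstanceAs (Module (DualNumber R) (Eps (A.base ⟶ B.base)))

variable {φ}

instance : Preadditive (DefCat φ) where
  add_comp A B C g g' f := by
    refine Eps.ext (Preadditive.add_comp _ _ _ g.re g'.re f.re) ?_
    change (g.im + g'.im) ≫ f.re + (g.re + g'.re) ≫ f.im +
        φ.1 A.base B.base C.base f.re (g.re + g'.re) =
      (g.im ≫ f.re + g.re ≫ f.im + φ.1 A.base B.base C.base f.re g.re) +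
        (g'.im ≫ f.re + g'.re ≫ f.im + φ.1 A.base B.base C.base f.re g'.re)
    simp only [Preadditive.add_comp, map_add]
    abel
  comp_add A B C g f f' := by
    refine Eps.ext (Preadditive.comp_add _ _ _ g.re f.re f'.re) ?_
    change g.im ≫ (f.re + f'.re) + g.re ≫ (f.im + f'.im) +
        φ.1 A.base B.base C.base (f.re + f'.re) g.re =
      (g.im ≫ f.re + g.re ≫ f.im + φ.1 A.base B.base C.base f.re g.re) +
        (g.im ≫ f'.re + g.re ≫ f'.im + φ.1 A.base B.base C.base f'.re g.re)
    simp only [Preadditive.comp_add, map_add, LinearMap.add_apply]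
    abel

instance : Linear (DualNumber R) (DefCat φ) where
  smul_comp A B C r g f := by
    refine Eps.ext (Linear.smul_comp _ _ _ r.fst g.re f.re) ?_
    change (r.fst • g.im + r.snd • g.re) ≫ f.re + (r.fst • g.re) ≫ f.im +
        φ.1 A.base B.base C.base f.re (r.fst • g.re) =
      r.fst • (g.im ≫ f.re + g.re ≫ f.im + φ.1 A.base B.base C.base f.re g.re) +
        r.snd • (g.re ≫ f.re)
    simp only [Preadditive.add_comp, Linear.smul_comp, map_smul, smul_add]
    abel
  comp_smul A B C g r f := by
    refine Eps.ext (Linear.comp_smul _ _ _ g.re r.fst f.re) ?_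
    change g.im ≫ (r.fst • f.re) + g.re ≫ (r.fst • f.im + r.snd • f.re) +
        φ.1 A.base B.base C.base (r.fst • f.re) g.re =
      r.fst • (g.im ≫ f.re + g.re ≫ f.im + φ.1 A.base B.base C.base f.re g.re) +
        r.snd • (g.re ≫ f.re)
    simp only [Preadditive.comp_add, Linear.comp_smul, map_smul, LinearMap.smul_apply, smul_add]
    abel

end DefCat

end Linear

/-! ## Precomplexes -/

section Precomplexes

variable {R : Type w} [CommRing R]

/-- A triple `(p, q, hpq)` of integers `p`, `q` and a proof of `p + n = q`. -/
abbrev Triplet (n : ℤ) : Type := CochainComplex.HomComplex.Triplet n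

/-- A precomplex: a `ℤ`-graded object together with a graded endomorphism of degree `1`. -/
structure Precomplex (b : Type u) [Category.{v} b] where
  X : ℤ → b
  δ : ∀ t : Triplet 1, X t.p ⟶ X t.q

/-- Graded morphisms of degree `n`, that is, `∏_p b(C^p, D^{p+n})`. -/
abbrev PHom {b : Type u} [Category.{v} b] (C D : Precomplex b) (n : ℤ) : Type v :=
  ∀ t : Triplet n, C.X t.p ⟶ D.X t.q

variable {b : Type u} [Category.{v} b] [Preadditive b] [Linear R b]

/-- The extension of a `2`-cochain to graded morphisms, `φ(f, g)_p = φ(f_{p + |g|}, g_p)`. -/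
def ext2 (φ : C2 R b) {C D E : Precomplex b} {p q n : ℤ} (h : p + q = n) :
    PHom D E p →ₗ[R] PHom C D q →ₗ[R] PHom C E n :=
  LinearMap.mk₂ R
    (fun f g t => φ _ _ _ (f ⟨t.p + q, t.q, by have := t.hpq; omega⟩) (g ⟨t.p, t.p + q, rfl⟩))
    (fun f f' g => by funext t; simp)
    (fun r f g => by funext t; simp)
    (fun f g g' => by funext t; simp)
    (fun r f g => by funext t; simp)

theorem ext2_apply (φ : C2 R b) {C D E : Precomplex b} {p q n : ℤ} (h : p + q = n)
    (f : PHom D E p) (g : PHom C D q) (i l j : ℤ) (hij : i + n = j) (hl : i + q = l)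
    (hlj : l + p = j) :
    ext2 φ h f g ⟨i, j, hij⟩ = φ _ _ _ (f ⟨l, j, hlj⟩) (g ⟨i, l, hl⟩) := by
  subst hl; rfl

theorem ext2_assoc {φ : C2 R b} (hφ : φ.IsAssoc) {C D E F : Precomplex b} {p q r pq qr n : ℤ}
    (hpq : p + q = pq) (hqr : q + r = qr) (h : pq + r = n) (h' : p + qr = n)
    (f : PHom E F p) (g : PHom D E q) (e : PHom C D r) :
    ext2 φ h (ext2 φ hpq f g) e = ext2 φ h' f (ext2 φ hqr g e) := by
  funext ⟨i, j, hij⟩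
  rw [ext2_apply φ h _ _ i (i + r) j hij rfl (by omega),
    ext2_apply φ hpq _ _ (i + r) (i + r + q) j (by omega) rfl (by omega),
    ext2_apply φ h' _ _ i (i + r + q) j hij (by omega) (by omega),
    ext2_apply φ hqr _ _ i (i + r) (i + r + q) (by omega) rfl rfl, hφ]

variable (R b)

/-- The quiver of precomplexes. -/
def preQuiver : GrQuiver.{w, v} R (Precomplex b) where
  Hom := PHom

variable {R b}

/-- The cochain `embr_δ(φ) = φ + φ{δ} + φ{δ, δ}` on the quiver of precomplexes: its component of
arity `2` is `φ`, its component of arity `1` is `f ↦ φ(δ, f) - (-1)^|f| φ(f, δ)` and its component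
of arity `0` is `-φ(δ, δ)`. -/
def embr (φ : C2 R b) : Cochain2 (preQuiver R b) where
  m h := ext2 φ h
  d {C D p q} h :=
    ext2 φ (show 1 + p = q by omega) D.δ - p.negOnePow • (ext2 φ h).flip C.δ
  c C := -ext2 φ (show (1 : ℤ) + 1 = 2 by norm_num) C.δ C.δ

theorem embr_d (φ : C2 R b) {C D : Precomplex b} {p q : ℤ} (h : p + 1 = q) (f : PHom C D p) :
    (embr φ).d h f =
      ext2 φ (show 1 + p = q by omega) D.δ f - p.negOnePow • ext2 φ h f C.δ := rfl

theorem ext2_ddd {φ : C2 R b} (hφ : φ.IsAssoc) (C : Precomplex b) :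
    ext2 φ (show (1 : ℤ) + 2 = 3 by norm_num) C.δ
        (-ext2 φ (show (1 : ℤ) + 1 = 2 by norm_num) C.δ C.δ) -
      Int.negOnePow 2 • ext2 φ (show (2 : ℤ) + 1 = 3 by norm_num)
        (-ext2 φ (show (1 : ℤ) + 1 = 2 by norm_num) C.δ C.δ) C.δ = 0 := by
  have := ext2_assoc hφ (C := C) (D := C) (E := C) (F := C) (show (1 : ℤ) + 1 = 2 by norm_num)
    (show (1 : ℤ) + 1 = 2 by norm_num) (show (2 : ℤ) + 1 = 3 by norm_num)
    (show (1 : ℤ) + 2 = 3 by norm_num) C.δ C.δ C.δ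
  simp [this, Int.negOnePow_even 2 (by decide)]

theorem ext2_dd {φ : C2 R b} (hφ : φ.IsAssoc) {C D : Precomplex b} {p q r : ℤ} (h : p + 1 = q)
    (h' : q + 1 = r) (f : PHom C D p) :
    ext2 φ (show 1 + q = r by omega) D.δ
        (ext2 φ (show 1 + p = q by omega) D.δ f - p.negOnePow • ext2 φ h f C.δ) -
      q.negOnePow • ext2 φ h'
        (ext2 φ (show 1 + p = q by omega) D.δ f - p.negOnePow • ext2 φ h f C.δ) C.δ =
    -(ext2 φ (show 2 + p = r by omega) (-ext2 φ (show (1 : ℤ) + 1 = 2 by norm_num) D.δ D.δ) f -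
      ext2 φ (show p + 2 = r by omega) f
        (-ext2 φ (show (1 : ℤ) + 1 = 2 by norm_num) C.δ C.δ)) := by
  have e1 := ext2_assoc hφ (show (1 : ℤ) + 1 = 2 by norm_num) (show 1 + p = q by omega)
    (show 2 + p = r by omega) (show 1 + q = r by omega) D.δ D.δ f
  have e2 := ext2_assoc hφ (show 1 + p = q by omega) h (show q + 1 = r by omega)
    (show 1 + q = r by omega) D.δ f C.δ
  have e3 := ext2_assoc hφ h (show (1 : ℤ) + 1 = 2 by norm_num) h'
    (show p + 2 = r by omega) f C.δ C.δ
  subst h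
  rw [Int.negOnePow_succ]
  rcases Int.units_eq_one_or p.negOnePow with hs | hs <;> rw [hs] <;>
    simp [e1, e2, e3] <;> abel

theorem ext2_leibniz {φ : C2 R b} (hφ : φ.IsAssoc) {A B C : Precomplex b} {p q n p' q' n' : ℤ}
    (h : p + q = n) (hp : p + 1 = p') (hq : q + 1 = q') (hn : n + 1 = n')
    (f : PHom B C p) (g : PHom A B q) :
    ext2 φ (show 1 + n = n' by omega) C.δ (ext2 φ h f g) -
        n.negOnePow • ext2 φ hn (ext2 φ h f g) A.δ =
      ext2 φ (show p' + q = n' by omega)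
        (ext2 φ (show 1 + p = p' by omega) C.δ f - p.negOnePow • ext2 φ hp f B.δ) g +
      p.negOnePow • ext2 φ (show p + q' = n' by omega) f
        (ext2 φ (show 1 + q = q' by omega) B.δ g - q.negOnePow • ext2 φ hq g A.δ) := by
  have e1 := ext2_assoc hφ (show 1 + p = p' by omega) h
    (show p' + q = n' by omega) (show 1 + n = n' by omega) C.δ f g
  have e2 := ext2_assoc hφ hp (show 1 + q = q' by omega)
    (show p' + q = n' by omega) (show p + q' = n' by omega) f B.δ g
  have e3 := ext2_assoc hφ h hq hn (show p + q' = n' by omega) f g A.δ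
  subst h
  rw [Int.negOnePow_add]
  rcases Int.units_eq_one_or p.negOnePow with hs | hs <;>
    rcases Int.units_eq_one_or q.negOnePow with ht | ht <;> rw [hs, ht] <;>
    simp [e1, e2, e3] <;> abel

theorem embr_isCDG {φ : C2 R b} (hφ : φ.IsAssoc) : (embr φ).IsCDG where
  d_c C := ext2_ddd hφ C
  d_d h h' f := ext2_dd hφ h h' f
  leibniz h hp hq hn f g := ext2_leibniz hφ h hp hq hn f g
  assoc hpq hqr h f g e := ext2_assoc hφ hpq hqr (by omega) (by omega) f g e

variable (R b)

/-- The cdg category of precomplexes, with `m` the composition, `d(f) = δ f - (-1)^|f| f δ` and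
curvature `c = -δ²`. -/
def pcom : Cochain2 (preQuiver R b) := embr (compC2 R b)

theorem pcom_isCDG : (pcom R b).IsCDG := embr_isCDG compC2_isAssoc

end Precomplexes

/-! ## Precomplexes over a linear deformation -/

section Lifts

variable {k : Type w} [CommRing k] {a : Type u} [Category.{v} a] [Preadditive a] [Linear k a]
variable {φ : Z2 k a}

/-- The reduction `k ⊗_{k[ε]} C` of a precomplex over `a_φ[ε]`. -/
def Precomplex.red (C : Precomplex (DefCat φ)) : Precomplex a where
  X i := (C.X i).base
  δ t := (C.δ t).re

variable (φ) in
/-- The lift `δ + δ'ε` of a precomplex. -/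
def Precomplex.lift (C : Precomplex a) (δ' : PHom C C 1) : Precomplex (DefCat φ) where
  X := C.X
  δ t := ⟨C.δ t, δ' t⟩

variable (φ) in
/-- The trivial precomplex `k[ε] ⊗ C`. -/
def Precomplex.triv (C : Precomplex a) : Precomplex (DefCat φ) := C.lift φ 0

/-- The canonical identification `PCom(a_φ[ε])(C, D)^n ≅ k[ε] ⊗ PCom(a)(k ⊗ C, k ⊗ D)^n`. -/
def redEquiv (C D : Precomplex (DefCat φ)) (n : ℤ) :
    PHom C D n ≃ₗ[DualNumber k] Eps (PHom C.red D.red n) where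
  toFun f := ⟨fun t => (f t).re, fun t => (f t).im⟩
  invFun f := fun t => ⟨f.re t, f.im t⟩
  left_inv _ := rfl
  right_inv _ := rfl
  map_add' _ _ := rfl
  map_smul' _ _ := rfl

/-- The same identification for lifts of given precomplexes. -/
def liftEquiv {C' D' : Precomplex (DefCat φ)} : ∀ {C D : Precomplex a}, C'.red = C → D'.red = D →
    ∀ n : ℤ, PHom C' D' n ≃ₗ[DualNumber k] Eps (PHom C D n)
  | _, _, rfl, rfl, n => redEquiv C' D' n

theorem redEquiv_ext2 {C D E : Precomplex (DefCat φ)} {p q n : ℤ} (h : p + q = n)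
    (f : PHom D E p) (g : PHom C D q) :
    redEquiv C E n (ext2 (compC2 (DualNumber k) (DefCat φ)) h f g) =
      epsBilin (ext2 (compC2 k a) h) (ext2 φ.1 h) (redEquiv D E p f) (redEquiv C D q g) := by
  rfl

theorem redEquiv_d {C D : Precomplex (DefCat φ)} {p q : ℤ} (h : p + 1 = q) (f : PHom C D p) :
    redEquiv C D q ((pcom (DualNumber k) (DefCat φ)).d h f) =
      epsBilin (ext2 (compC2 k a) (by omega)) (ext2 φ.1 (show 1 + p = q by omega))
          (redEquiv D D 1 D.δ) (redEquiv C D p f) -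
        p.negOnePow • epsBilin (ext2 (compC2 k a) h) (ext2 φ.1 h)
          (redEquiv C D p f) (redEquiv C C 1 C.δ) := by
  rw [← redEquiv_ext2, ← redEquiv_ext2]
  rfl

theorem redEquiv_c (C : Precomplex (DefCat φ)) :
    redEquiv C C 2 ((pcom (DualNumber k) (DefCat φ)).c C) =
      -epsBilin (ext2 (compC2 k a) (by norm_num)) (ext2 φ.1 (show (1 : ℤ) + 1 = 2 by norm_num))
          (redEquiv C C 1 C.δ) (redEquiv C C 1 C.δ) := by
  rw [← redEquiv_ext2]
  rfl

theorem lift_m_re {C' D' E' : Precomplex (DefCat φ)} {C D E : Precomplex a} (hC : C'.red = C)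
    (hD : D'.red = D) (hE : E'.red = E) {p q n : ℤ} (h : p + q = n)
    (f : PHom D' E' p) (g : PHom C' D' q) :
    (liftEquiv hC hE n ((pcom (DualNumber k) (DefCat φ)).m h f g)).re =
      (pcom k a).m h (liftEquiv hD hE p f).re (liftEquiv hC hD q g).re := by
  subst hC hD hE; rfl

theorem lift_d_re {C' D' : Precomplex (DefCat φ)} {C D : Precomplex a} (hC : C'.red = C)
    (hD : D'.red = D) {p q : ℤ} (h : p + 1 = q) (f : PHom C' D' p) :
    (liftEquiv hC hD q ((pcom (DualNumber k) (DefCat φ)).d h f)).re =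
      (pcom k a).d h (liftEquiv hC hD p f).re := by
  subst hC hD; rfl

theorem lift_c_re {C' : Precomplex (DefCat φ)} {C : Precomplex a} (hC : C'.red = C) :
    (liftEquiv hC hC 2 ((pcom (DualNumber k) (DefCat φ)).c C')).re = (pcom k a).c C := by
  subst hC; rfl

/-- Let `Γ` be a family of lifts to precomplexes over `a_φ[ε]` of a family `o` of precomplexes over
`a`. The category spanned by `Γ` (the full subcategory of `PCom(a_φ[ε])`, if the objects are
distinct) is a cdg deformation of the category spanned by `o`. -/
def spanDeformation {T : Type u'} (o : T → Precomplex a) (Γ : T → Precomplex (DefCat φ))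
    (hΓ : ∀ t, (Γ t).red = o t) : Deformation ((pcom k a).pull o) where
  quiv := (preQuiver (DualNumber k) (DefCat φ)).pull Γ
  e A B n := liftEquiv (hΓ A) (hΓ B) n
  str := (pcom (DualNumber k) (DefCat φ)).pull Γ
  isCDG := (pcom_isCDG (DualNumber k) (DefCat φ)).pull Γ
  red_m h f g := lift_m_re (hΓ _) (hΓ _) (hΓ _) h f g
  red_d h f := lift_d_re (hΓ _) (hΓ _) h f
  red_c A := lift_c_re (hΓ A)

theorem rearrange_d {M : Type*} [AddCommGroup M] (s : ℤˣ) (x₁ x₂ x₃ y₁ y₂ y₃ : M) :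
    (x₁ + x₂ + x₃) - s • (y₁ + y₂ + y₃) =
      (x₁ - s • y₂) + ((x₃ - s • y₃) + (x₂ - s • y₁)) := by
  rw [smul_add, smul_add]; abel

theorem rearrange_c {M : Type*} [AddCommGroup M] (x y z : M) :
    -(x + y + z) = -z + -(x - Int.negOnePow 1 • y) := by
  rw [Int.negOnePow_one, Units.neg_smul, one_smul]; abel

variable (φ) in
theorem embr_coboundary_isCDG {T : Type*} (o : T → Precomplex a)
    (h : ∀ t, PHom (o t) (o t) 1) :
    (((pcom k a).pull o).eps
      ((embr φ.1).pull o + ((pcom k a).pull o).coboundaryZero h)).IsCDG := by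
  refine ((pcom_isCDG (DualNumber k) (DefCat φ)).pull (fun t => (o t).lift φ (h t))).transfer
    (fun A B n => redEquiv ((o A).lift φ (h A)) ((o B).lift φ (h B)) n) ?_ ?_ ?_
  · intro A B C p q n hpq f g
    refine (redEquiv_ext2 hpq f g).trans ?_
    exact (LinearMap.congr_fun₂ (congrArg (epsBilin (ext2 (compC2 k a) hpq)) (add_zero _)) _ _).symm
  · intro A B p q hpq f
    exact (redEquiv_d hpq f).trans (Eps.ext rfl (rearrange_d _ _ _ _ _ _ _))
  · intro A
    exact (redEquiv_c _).trans (Eps.ext rfl (rearrange_c _ _ _))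

end Lifts

/-! ## Realization of cocycles as deformations -/

section Realization

variable {k : Type w} [CommRing k] {a : Type u} [Category.{v} a] [Preadditive a] [Linear k a]

/-- The structure `μ + (embr_δ(φ) + d(h))ε` on `k[ε] ⊗ Q`, where `(Q, μ)` is the category spanned by
a family `o` of precomplexes and `h` is a Hochschild cochain on it of arity `0` and degree `1`. -/
def embrDeformation (φ : Z2 k a) {T : Type u'} (o : T → Precomplex a)
    (h : ∀ t, PHom (o t) (o t) 1) : Deformation ((pcom k a).pull o) where
  quiv := ((preQuiver k a).pull o).eps
  e _ _ _ := LinearEquiv.refl _ _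
  str := ((pcom k a).pull o).eps ((embr φ.1).pull o + ((pcom k a).pull o).coboundaryZero h)
  isCDG := embr_coboundary_isCDG φ o h
  red_m _ _ _ := rfl
  red_d _ _ := rfl
  red_c _ := rfl

theorem coboundary_zero_d {C D : Precomplex a} {p q : ℤ} {h : p + 1 = q} (f : PHom C D p)
    (x : PHom C D q) :
    x + (ext2 (compC2 k a) (show 1 + p = q by omega) (0 : PHom D D 1) f -
      p.negOnePow • ext2 (compC2 k a) h f (0 : PHom C C 1)) = x := by
  simp

theorem coboundary_zero_c {C : Precomplex a} (x : (preQuiver k a).Hom C C 2) :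
    x + -(pcom k a).d (show (1 : ℤ) + 1 = 2 by norm_num) (0 : (preQuiver k a).Hom C C 1) = x := by
  rw [map_zero, neg_zero, add_zero]

theorem realization_isCDG (φ : Z2 k a) : ((pcom k a).eps (embr φ.1)).IsCDG := by
  have h0 : (embr φ.1).pull id + ((pcom k a).pull id).coboundaryZero (fun C => (0 : PHom C C 1)) =
      embr φ.1 := by
    refine congr (congr (congrArg Cochain2.mk ?_) ?_) ?_
    · funext A B C p q n h
      exact add_zero _
    · funext A B p q h
      exact LinearMap.ext fun f => coboundary_zero_d (h := h) (f : PHom A B p) _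
    · funext A
      exact coboundary_zero_c _
  have := embr_coboundary_isCDG φ (id : Precomplex a → Precomplex a) (fun C => (0 : PHom C C 1))
  rw [h0] at this
  exact this

/-- The realization `R(φ)`: the cdg deformation `(k[ε] ⊗ PCom(a), μ + embr_δ(φ)ε)`. -/
def realization (φ : Z2 k a) : Deformation (pcom k a) where
  quiv := (preQuiver k a).eps
  e _ _ _ := LinearEquiv.refl _ _
  str := (pcom k a).eps (embr φ.1)
  isCDG := realization_isCDG φ
  red_m _ _ _ := rfl
  red_d _ _ := rfl
  red_c _ := rfl

/-- The subcategory `PCom_Γ(a_φ[ε])` spanned by a collection `Γ` of lifts of all precomplexes, as a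
cdg deformation of `PCom(a)`. -/
def pcomSpan (φ : Z2 k a) (Γ : ∀ C : Precomplex a, {C' : Precomplex (DefCat φ) // C'.red = C}) :
    Deformation (pcom k a) :=
  spanDeformation (o := id) (fun C => (Γ C).1) (fun C => (Γ C).2)

/-- The subcategory `PCom_triv(a_φ[ε])` of trivial precomplexes. -/
def pcomTriv (φ : Z2 k a) : Deformation (pcom k a) :=
  pcomSpan φ (fun C => ⟨C.triv φ, rfl⟩)

/-! ## Complexes -/

/-- A precomplex is a complex if `δ² = 0`. -/
def Precomplex.IsComplex {b : Type u} [Category.{v} b] [Preadditive b] (C : Precomplex b) : Prop :=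
  ∀ (p q r : ℤ) (h : p + 1 = q) (h' : q + 1 = r), C.δ ⟨p, q, h⟩ ≫ C.δ ⟨q, r, h'⟩ = 0

/-- Bounded below complexes. -/
def ComPlus (b : Type u) [Category.{v} b] [Preadditive b] : Type (max u v) :=
  {C : Precomplex b // C.IsComplex ∧ ∃ n : ℤ, ∀ i < n, Limits.IsZero (C.X i)}

/-- The underlying precomplex. -/
def ComPlus.pre {b : Type u} [Category.{v} b] [Preadditive b] (C : ComPlus b) : Precomplex b := C.1

variable (k a) in
/-- The dg category of bounded below complexes, as a full subcategory of `PCom(a)`. -/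
def comPlus : Cochain2 ((preQuiver k a).pull (ComPlus.pre (b := a))) :=
  (pcom k a).pull ComPlus.pre

theorem pcom_c_eq_zero {C : Precomplex a} (hC : C.IsComplex) : (pcom k a).c C = 0 := by
  refine neg_eq_zero.mpr (funext fun t => ?_)
  exact hC _ _ _ _ _

/-- The objects of `Com⁺(a)_{φ-∞}`: the complexes `C` for which the class of
`(embr_δ(φ))_C = -φ(δ_C, δ_C)` in `H²(Com⁺(a)(C, C))` is zero. -/
def phiInf (φ : Z2 k a) : Set (ComPlus a) :=
  {C | ∃ h : PHom C.pre C.pre 1,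
    (pcom k a).d (show (1 : ℤ) + 1 = 2 by norm_num) h = (embr φ.1).c C.pre}

/-- For `h ∈ ∏_C Com⁺(a)(C, C)¹` with `d(h_C) = (embr_δ(φ))_C` for all `C ∈ Com⁺(a)_{φ-∞}`, the
partial dg deformation of `Com⁺(a)` determined by the cocycle `embr_δ(φ) + d(h)`, the
component of arity `0` of which is zero, on `Com⁺(a)_{φ-∞}`. -/
def embrPartial (φ : Z2 k a) (h : ∀ C : phiInf φ, PHom C.1.pre C.1.pre 1)
    (hh : ∀ C : phiInf φ,
      (pcom k a).d (show (1 : ℤ) + 1 = 2 by norm_num) (h C) = (embr φ.1).c C.1.pre) :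
    PartialDG (comPlus k a) where
  S := phiInf φ
  D := embrDeformation φ (fun C : phiInf φ => C.1.pre) h
  isDG C := by
    refine Eps.ext (pcom_c_eq_zero C.1.2.1) ?_
    exact (congrArg (fun x => (embr φ.1).c C.1.pre + -x) (hh C)).trans (add_neg_cancel _)

/-- The map `ρ' : HH²(a) → HH²(Com⁺(a)) → Sk(dg-pDef)`: the class of the partial deformation
determined by a representing cocycle `φ` and a choice of `h` as in `embrPartial`. -/
noncomputable def rhoPrime (x : HH2 k a) : PartialDG.Sk (comPlus k a) :=
  PartialDG.Sk.mk (embrPartial (Quotient.out x) (fun C => Classical.choose C.2)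
    (fun C => Classical.choose_spec C.2))

/-- The full subcategory `Com⁺_Γ(a_φ[ε])` of `Com⁺(a_φ[ε])` spanned by a collection `Γ` of lifts of
the complexes in `Com⁺(a)_{φ-∞}` to complexes over `a_φ[ε]`, as a partial dg deformation. -/
def comSpan (φ : Z2 k a)
    (Γ : ∀ C : phiInf φ, {C' : Precomplex (DefCat φ) // C'.red = C.1.pre ∧ C'.IsComplex}) :
    PartialDG (comPlus k a) where
  S := phiInf φ
  D := spanDeformation (o := fun C : phiInf φ => C.1.pre) (fun C => (Γ C).1) (fun C => (Γ C).2.1)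
  isDG C := pcom_c_eq_zero (Γ C).2.2

/-- The complex with `A` in degree `0` and the zero object `Z` in all other degrees. -/
def stalk (A Z : a) (hZ : Limits.IsZero Z) : ComPlus a :=
  ⟨⟨fun i => if i = 0 then A else Z, fun _ => 0⟩, by
    intro p q r h h'; simp, ⟨0, fun i hi => by
      change Limits.IsZero (if i = 0 then A else Z)
      rw [if_neg (by omega)]; exact hZ⟩⟩

end Realization

end LowenDef

open LowenDef

/-!
In a category of precomplexes the differential and the curvature are determined by the composition
and the elements `δ`: `d = [δ, -]` and `c = -δ²`. Hence a multiplicative map `G` between two such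
categories extends to a morphism of cdg categories with component `G(δ) - δ'` in arity `0`. For
`G = id` this shows that the choice of lifts of the differentials does not matter; for
`G = 1 + gε` with `φ = φ' + d(g)` it shows that cohomologous cocycles give isomorphic deformations.
Moreover `C` belongs to `Com⁺(a)_{φ-∞}` exactly if `δ` lifts to a differential of square zero over
`a_φ[ε]`.

Conversely, a deformation `D` of a full subcategory of `Com⁺(a)` containing the stalk complexes
restricts to `a_φ[ε]` on these, for a cocycle `φ` whose class depends only on the isomorphism class
of `D`. Every morphism in `D` from a stalk complex to `C` factors uniquely through the inclusion of
the stalk complex of some `C^p`, so, as in the Yoneda lemma, `C` is reconstructed as a precomplex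
over `a_φ[ε]`. Thus `D` is a full subcategory of the deformation given by `φ`. This yields the
maximality of the latter, as well as the injectivity and the image of `ρ`.
-/

namespace LowenDef

/-! ### Curved functors -/

section CurvedFunctors

variable {R : Type w} [CommRing R] {T : Type u}

namespace Path

variable {Q : GrQuiver.{w, v} R T} {M : Type v} [AddCommGroup M] {A C : T}

theorem sumSplit_eq_zero (p : Path Q A C) (Φ : ∀ B : T, Path Q B C → Path Q A B → M)
    (h : ∀ B l r, Φ B l r = 0) : p.sumSplit Φ = 0 := by
  induction p with
  | nil => exact h _ _ _
  | cons f p ih => rw [sumSplit, h, zero_add]; exact ih _ fun _ _ _ => h _ _ _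

theorem sumInsert_eq_zero {μ : Cochain2 Q} (p : Path Q A C) (Φ : Path Q A C → M)
    (h : ∀ {B : T} {n : ℤ} (f : Q.Hom B C n) (q : Path Q A B), Φ (cons f q) = 0) :
    p.sumInsert μ Φ = 0 := by
  induction p with
  | nil => exact h _ _
  | cons f p ih =>
    rw [sumInsert, h, h, ih _ fun _ _ => h _ _]
    cases p with
    | nil => simp [contractFirst]
    | cons g p => simp [contractFirst, h]

end Path

/-- A morphism of cdg categories with fixed objects: an `A_{[0,∞[}`-morphism with components in
arities `0` and `1` only. -/
structure CurvedFunctor {Q Q' : GrQuiver.{w, v} R T} (μ : Cochain2 Q) (μ' : Cochain2 Q') where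
  F₀ : ∀ A : T, Q'.Hom A A 1
  F₁ : ∀ (A B : T) (n : ℤ), Q.Hom A B n →ₗ[R] Q'.Hom A B n
  map_c : ∀ A : T,
    μ'.c A - μ'.d (show (1 : ℤ) + 1 = 2 by norm_num) (F₀ A) -
        μ'.m (show (1 : ℤ) + 1 = 2 by norm_num) (F₀ A) (F₀ A) = F₁ A A 2 (μ.c A)
  map_d : ∀ {A B : T} {p q : ℤ} (h : p + 1 = q) (f : Q.Hom A B p),
    F₁ A B q (μ.d h f) = μ'.d h (F₁ A B p f) +
      μ'.m (show 1 + p = q by omega) (F₀ B) (F₁ A B p f) -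
        p.negOnePow • μ'.m h (F₁ A B p f) (F₀ A)
  map_m : ∀ {A B C : T} {p q n : ℤ} (h : p + q = n) (f : Q.Hom B C p) (g : Q.Hom A B q),
    F₁ A C n (μ.m h f g) = μ'.m h (F₁ B C p f) (F₁ A B q g)

namespace CurvedFunctor

variable {Q Q' Q'' : GrQuiver.{w, v} R T} {μ'' : Cochain2 Q''} {μ' : Cochain2 Q'} {μ : Cochain2 Q}

/-- The components of the `A_{[0,∞[}`-morphism determined by a curved functor. -/
def onPath (F : CurvedFunctor μ μ') : ∀ {A B : T}, Path Q A B → ∀ e : ℤ, Q'.Hom A B e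
  | _, _, .nil A, e => if h : (1 : ℤ) = e then h ▸ F.F₀ A else 0
  | A, B, .cons (n := n) f (.nil _), e => if h : n = e then h ▸ F.F₁ A B n f else 0
  | _, _, .cons _ (.cons _ _), _ => 0

theorem onPath_nil (F : CurvedFunctor μ μ') (A : T) : F.onPath (.nil A) 1 = F.F₀ A := by
  simp [onPath]

theorem onPath_nil_of_ne (F : CurvedFunctor μ μ') {A : T} {e : ℤ} (h : 1 ≠ e) :
    F.onPath (.nil A) e = 0 := by
  simp [onPath, h]

theorem onPath_single (F : CurvedFunctor μ μ') {A B : T} {n : ℤ} (f : Q.Hom A B n) :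
    F.onPath (.cons f (.nil A)) n = F.F₁ A B n f := by
  simp [onPath]

theorem onPath_single_of_ne (F : CurvedFunctor μ μ') {A B : T} {n e : ℤ} (h : n ≠ e)
    (f : Q.Hom A B n) : F.onPath (.cons f (.nil A)) e = 0 := by
  simp [onPath, h]

@[simp] theorem onPath_cons_cons (F : CurvedFunctor μ μ') {A B C D : T} {n n' : ℤ}
    (f : Q.Hom C D n) (g : Q.Hom B C n') (p : Path Q A B) (e : ℤ) :
    F.onPath (.cons f (.cons g p)) e = 0 := rfl

theorem onPath_sdeg (F : CurvedFunctor μ μ') {A B : T} (p : Path Q A B) {e : ℤ}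
    (h : e ≠ p.sdeg + 1) : F.onPath p e = 0 := by
  match p with
  | .nil _ => exact F.onPath_nil_of_ne (by simpa [Path.sdeg] using h.symm)
  | .cons f (.nil _) => exact F.onPath_single_of_ne (by simpa [Path.sdeg] using h.symm) f
  | .cons _ (.cons _ _) => rfl

theorem exists_linearMap_onPath_append_cons (F : CurvedFunctor μ μ') {A B C D : T} {n : ℤ}
    (l : Path Q C D) (r : Path Q A B) (e : ℤ) :
    ∃ L : Q.Hom B C n →ₗ[R] Q'.Hom A D e, ∀ f, F.onPath (l.append (.cons f r)) e = L f := by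
  match l, r with
  | .nil _, .nil _ =>
    by_cases h : n = e
    · subst h
      exact ⟨F.F₁ _ _ n, F.onPath_single⟩
    · exact ⟨0, F.onPath_single_of_ne h⟩
  | .nil _, .cons _ _ => exact ⟨0, fun _ => rfl⟩
  | .cons _ (.nil _), _ => exact ⟨0, fun _ => rfl⟩
  | .cons _ (.cons _ _), _ => exact ⟨0, fun _ => rfl⟩

theorem m_onPath_nil_single (F : CurvedFunctor μ μ') {A B : T} {n x y e : ℤ} (f : Q.Hom A B n)
    (hx : x = 1) (hy : y = n) (h : x + y = e) :
    μ'.m h (F.onPath (.nil B) x) (F.onPath (.cons f (.nil A)) y) =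
      μ'.m (show 1 + n = e by omega) (F.F₀ B) (F.F₁ A B n f) := by
  subst hx hy; rw [onPath_nil, onPath_single]

theorem m_onPath_single_nil (F : CurvedFunctor μ μ') {A B : T} {n x y e : ℤ} (f : Q.Hom A B n)
    (hx : x = n) (hy : y = 1) (h : x + y = e) :
    μ'.m h (F.onPath (.cons f (.nil A)) x) (F.onPath (.nil A) y) =
      μ'.m (show n + 1 = e by omega) (F.F₁ A B n f) (F.F₀ A) := by
  subst hx hy; rw [onPath_nil, onPath_single]

theorem m_onPath_single_single (F : CurvedFunctor μ μ') {A B C : T} {n n' x y e : ℤ}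
    (f : Q.Hom B C n) (g : Q.Hom A B n') (hx : x = n) (hy : y = n') (h : x + y = e) :
    μ'.m h (F.onPath (.cons f (.nil B)) x) (F.onPath (.cons g (.nil A)) y) =
      μ'.m (show n + n' = e by omega) (F.F₁ B C n f) (F.F₁ A B n' g) := by
  subst hx hy; rw [onPath_single, onPath_single]

theorem onPath_d (F : CurvedFunctor μ μ') {A B : T} {n e : ℤ} (h : n + 1 = e)
    (f : Q.Hom A B n) :
    F.onPath (.cons (μ.d rfl f) (.nil A)) e = F.F₁ A B e (μ.d h f) := by
  subst h; rw [onPath_single]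

theorem onPath_m (F : CurvedFunctor μ μ') {A B C : T} {p q n : ℤ} (h : p + q = n)
    (f : Q.Hom B C p) (g : Q.Hom A B q) :
    F.onPath (.cons (μ.m rfl f g) (.nil A)) n = F.F₁ A C n (μ.m h f g) := by
  subst h; rw [onPath_single]

/-- In arities `1` and `2` this is the compatibility with `d` and `m`; in higher arities both sides
vanish. -/
theorem onPath_eq_cons (F : CurvedFunctor μ μ') {A B C : T} {n : ℤ} (f : Q.Hom B C n)
    (p : Path Q A B) (i e : ℤ) (hi : (Path.cons f p).sdeg + 1 = i) (he : i + 1 = e) :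
    -μ'.d he (F.onPath (.cons f p) i) +
        (Path.cons f p).sumSplit (fun _ l r => (l.sdeg + 1).negOnePow •
          μ'.m (add_sub_cancel (l.sdeg + 1) e)
            (F.onPath l (l.sdeg + 1)) (F.onPath r (e - (l.sdeg + 1)))) =
      (Path.cons f p).sumInsert μ (fun q => F.onPath q e) := by
  cases p with
  | nil =>
    obtain rfl : i = n := by simpa [Path.sdeg] using hi.symm
    rw [onPath_single]
    simp only [Path.sumSplit, Path.sumInsert, Path.contractFirst, onPath_cons_cons, smul_zero,
      add_zero, zero_sub]
    rw [m_onPath_nil_single _ _ (by simp [Path.sdeg]) (by simp [Path.sdeg]; omega),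
      m_onPath_single_nil _ _ (by simp [Path.sdeg]) (by simp [Path.sdeg]; omega),
      F.onPath_d he, F.map_d]
    simp only [Path.sdeg, zero_add, add_zero, sub_add_cancel, Int.negOnePow_one,
      Units.neg_smul, one_smul]
    abel
  | @cons _ _ n' g p =>
    rw [onPath_cons_cons, map_zero, neg_zero, zero_add]
    cases p with
    | nil =>
      obtain rfl : e = n + n' := by simp [Path.sdeg] at hi; omega
      simp only [Path.sumSplit, Path.sumInsert, Path.contractFirst, onPath_cons_cons, smul_zero,
        add_zero, map_zero, zero_sub, neg_zero, zero_add, LinearMap.zero_apply]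
      rw [m_onPath_single_single _ _ _ (by simp [Path.sdeg]) (by simp [Path.sdeg]),
        F.onPath_m rfl, F.map_m]
      simp [Path.sdeg]
    | cons x p =>
      rw [Path.sumInsert, Path.sumInsert_eq_zero _ _ fun _ _ => onPath_cons_cons _ _ _ _ _]
      simp only [Path.sumSplit, Path.contractFirst, onPath_cons_cons, smul_zero, add_zero,
        map_zero, sub_zero, zero_add, LinearMap.zero_apply]
      exact Path.sumSplit_eq_zero _ _ (by intros; simp)

/-- The `A_{[0,∞[}`-morphism determined by a curved functor. -/
def toAMor (F : CurvedFunctor μ μ') : AMor μ μ' where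
  F := F.onPath
  F_deg p _ := F.onPath_sdeg p
  F_add l f g r e := by
    obtain ⟨L, hL⟩ := F.exists_linearMap_onPath_append_cons l r e
    rw [hL, hL, hL, map_add]
  F_smul l x f r e := by
    obtain ⟨L, hL⟩ := F.exists_linearMap_onPath_append_cons l r e
    rw [hL, hL, map_smul]
  eq_nil A := by
    rw [onPath_nil, onPath_single]; exact F.map_c A
  eq_cons := F.onPath_eq_cons

/-- Composition of curved functors. -/
def comp (G : CurvedFunctor μ' μ'') (F : CurvedFunctor μ μ') : CurvedFunctor μ μ'' where
  F₀ A := G.F₀ A + G.F₁ A A 1 (F.F₀ A)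
  F₁ A B n := (G.F₁ A B n).comp (F.F₁ A B n)
  map_c A := by
    rw [LinearMap.comp_apply, ← F.map_c, map_sub, map_sub, ← G.map_c, G.map_d, G.map_m]
    simp only [map_add, LinearMap.add_apply, Int.negOnePow_one, Units.neg_smul, one_smul]
    abel
  map_d h f := by
    simp only [LinearMap.comp_apply, F.map_d, map_add, map_sub, G.map_d, G.map_m,
      LinearMap.add_apply, smul_add, Units.smul_def, map_zsmul]
    abel
  map_m h f g := by
    simp only [LinearMap.comp_apply, F.map_m, G.map_m]

end CurvedFunctor

/-- A cochain is inner for a family `δ` of elements of degree `1` if its differential is the graded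
commutator with `δ` and its curvature is `-δ²`, as for precomplexes. -/
structure Cochain2.IsInner {Q : GrQuiver.{w, v} R T} (μ : Cochain2 Q)
    (δ : ∀ A : T, Q.Hom A A 1) : Prop where
  d_eq : ∀ {A B : T} {p q : ℤ} (h : p + 1 = q) (f : Q.Hom A B p),
    μ.d h f = μ.m (show 1 + p = q by omega) (δ B) f - p.negOnePow • μ.m h f (δ A)
  c_eq : ∀ A : T, μ.c A = -μ.m (show (1 : ℤ) + 1 = 2 by norm_num) (δ A) (δ A)

/-- Between inner structures, every map compatible with the compositions is the arity `1` part of a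
curved functor. -/
def CurvedFunctor.ofIsInner {Q Q' : GrQuiver.{w, v} R T} {μ : Cochain2 Q} {μ' : Cochain2 Q'}
    {δ : ∀ A : T, Q.Hom A A 1} {δ' : ∀ A : T, Q'.Hom A A 1} (hμ : μ.IsInner δ)
    (hμ' : μ'.IsInner δ') (G : ∀ (A B : T) (n : ℤ), Q.Hom A B n →ₗ[R] Q'.Hom A B n)
    (hG : ∀ {A B C : T} {p q n : ℤ} (h : p + q = n) (f : Q.Hom B C p) (g : Q.Hom A B q),
      G A C n (μ.m h f g) = μ'.m h (G B C p f) (G A B q g)) : CurvedFunctor μ μ' where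
  F₀ A := G A A 1 (δ A) - δ' A
  F₁ := G
  map_c A := by
    rw [hμ.c_eq, hμ'.c_eq, hμ'.d_eq, map_neg, hG]
    simp only [map_sub, LinearMap.sub_apply, Int.negOnePow_one, Units.neg_smul, one_smul]
    abel
  map_d h f := by
    rw [hμ.d_eq, hμ'.d_eq, map_sub, Units.smul_def, map_zsmul, hG, hG]
    simp only [map_sub, LinearMap.sub_apply, smul_sub, Units.smul_def]
    abel
  map_m := hG

namespace AMor

variable {Q Q' : GrQuiver.{w, v} R T} {μ : Cochain2 Q} {ν : Cochain2 Q'} (F : AMor μ ν)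

/-- The arity `1` part of an `A_{[0,∞[}`-morphism, on elements of degree `n`. -/
def linear (A B : T) (n : ℤ) : Q.Hom A B n →ₗ[R] Q'.Hom A B n where
  toFun f := F.F (.cons f (.nil A)) n
  map_add' f g := F.F_add (.nil B) f g (.nil A) n
  map_smul' x f := F.F_smul (.nil B) x f (.nil A) n

theorem map_append_cons_zero {A B C D : T} {n : ℤ} (l : Path Q C D) (r : Path Q A B) (e : ℤ) :
    F.F (l.append (.cons (0 : Q.Hom B C n) r)) e = 0 := by
  rw [← zero_smul R (0 : Q.Hom B C n), F.F_smul, zero_smul]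

theorem m_single_single {A B C : T} {p q x y n : ℤ} (f : Q.Hom B C p) (g : Q.Hom A B q)
    (hx : x = p) (hy : y = q) (h : x + y = n) :
    ν.m h (F.F (.cons f (.nil B)) x) (F.F (.cons g (.nil A)) y) =
      ν.m (show p + q = n by omega) (F.linear B C p f) (F.linear A B q g) := by
  subst hx hy; rfl

theorem map_single_m {A B C : T} {p q n : ℤ} (h : p + q = n) (f : Q.Hom B C p) (g : Q.Hom A B q) :
    F.F (.cons (μ.m rfl f g) (.nil A)) n = F.linear A C n (μ.m h f g) := by
  subst h; rfl

/-- Without curvature and differentials, the `A_{[0,∞[}`-equation in arity `2` says that the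
component of arity `2` measures the failure of the component of arity `1` to be multiplicative. -/
theorem linear_m {A B C : T} {p q n : ℤ} (h : p + q = n) (f : Q.Hom B C p) (g : Q.Hom A B q)
    (hA : μ.c A = 0) (hB : μ.c B = 0) (hC : μ.c C = 0) (hf : μ.d rfl f = 0) (hg : μ.d rfl g = 0)
    (hF : ∀ e, F.F (.cons f (.cons g (.nil A))) e = 0) :
    F.linear A C n (μ.m h f g) = ν.m h (F.linear B C p f) (F.linear A B q g) := by
  have z₁ := F.map_append_cons_zero (n := 2) (.nil C) (.cons f (.cons g (.nil A))) n
  have z₂ := F.map_append_cons_zero (n := 2) (.cons f (.nil B)) (.cons g (.nil A)) n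
  have z₃ := F.map_append_cons_zero (n := 2) (.cons f (.cons g (.nil A))) (.nil A) n
  have z₄ := F.map_append_cons_zero (n := p + 1) (.nil C) (.cons g (.nil A)) n
  have z₅ := F.map_append_cons_zero (n := q + 1) (.cons f (.nil B)) (.nil A) n
  simp only [Path.append] at z₁ z₂ z₃ z₄ z₅
  have key := F.eq_cons f (.cons g (.nil A)) (n - 1) n (by simp [Path.sdeg]; omega) (by omega)
  simp only [Path.sumSplit, Path.sumInsert, Path.contractFirst] at key
  rw [hA, hB, hC, hf, hg, z₁, z₂, z₃, z₄, z₅, hF, hF, hF,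
    F.m_single_single f g (by simp [Path.sdeg]) (by simp [Path.sdeg]; omega),
    F.map_single_m h] at key
  simpa [Path.sdeg] using key.symm

end AMor

theorem Cochain2.add_coboundaryZero_zero {Q : GrQuiver.{w, v} R T} (μ ν : Cochain2 Q) :
    ν + μ.coboundaryZero (fun _ => 0) = ν := by
  obtain ⟨m, d, c⟩ := ν
  change Cochain2.mk _ _ _ = _
  congr 1
  · funext A B C p q n h
    exact add_zero _
  · funext A B p q h
    ext f
    simp [coboundaryZero]
  · funext A
    simp [coboundaryZero]

end CurvedFunctors

namespace Deformation

variable {k : Type w} [CommRing k] {T : Type u} {Q : GrQuiver.{w, v} k T} {μ : Cochain2 Q}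
  {D D' D'' : Deformation μ}

/-- Two deformations are isomorphic by a curved functor reducing to the identity. -/
def CurvedIso (D D' : Deformation μ) : Prop :=
  ∃ F : CurvedFunctor D.str D'.str,
    (∀ A : T, (D'.e A A 1 (F.F₀ A)).re = 0) ∧
    ∀ {A B : T} {n : ℤ} (f : D.quiv.Hom A B n), (D'.e A B n (F.F₁ A B n f)).re = (D.e A B n f).re

theorem CurvedIso.iso (h : D.CurvedIso D') : D.Iso D' := by
  obtain ⟨F, h₀, h₁⟩ := h
  refine ⟨F.toAMor, fun A i => ?_, fun {A B n} f => ?_, fun f g p i => ?_⟩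
  · change (D'.e A A i (F.onPath (.nil A) i)).re = 0
    by_cases hi : 1 = i
    · subst hi; rw [F.onPath_nil, h₀]
    · rw [F.onPath_nil_of_ne hi, map_zero, Eps.re_zero]
  · change (D'.e A B n (F.onPath (.cons f (.nil A)) n)).re = _
    rw [F.onPath_single, h₁]
  · change (D'.e _ _ i (F.onPath (.cons f (.cons g p)) i)).re = 0
    rw [F.onPath_cons_cons, map_zero, Eps.re_zero]

theorem CurvedIso.trans (h : D.CurvedIso D') (h' : D'.CurvedIso D'') : D.CurvedIso D'' := by
  obtain ⟨F, h₀, h₁⟩ := h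
  obtain ⟨G, h₀', h₁'⟩ := h'
  refine ⟨G.comp F, fun A => ?_, fun f => (h₁' _).trans (h₁ f)⟩
  change (D''.e A A 1 (G.F₀ A + G.F₁ A A 1 (F.F₀ A))).re = 0
  rw [map_add, Eps.re_add, h₀', h₁', h₀, add_zero]

theorem Coincide.refl (D : Deformation μ) : D.Coincide D :=
  ⟨fun _ _ _ => rfl, fun _ _ => rfl, fun _ => rfl⟩

theorem Coincide.symm (h : D.Coincide D') : D'.Coincide D :=
  ⟨fun h' f g => (h.1 h' f g).symm, fun h' f => (h.2.1 h' f).symm, fun A => (h.2.2 A).symm⟩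

theorem Coincide.curvedIso (h : D.Coincide D') : D.CurvedIso D' := by
  obtain ⟨hm, hd, hc⟩ := h
  refine ⟨⟨fun _ => 0, fun A B n => ((D.e A B n).trans (D'.e A B n).symm).toLinearMap,
    fun A => ?_, fun {A B p q} h f => ?_, fun {A B C p q n} h f g => ?_⟩,
    fun A => ?_, fun f => ?_⟩
  · rw [map_zero, map_zero, sub_zero, sub_zero]
    exact (LinearEquiv.eq_symm_apply _).2 (hc A).symm
  · rw [map_zero, map_zero, smul_zero, sub_zero, LinearMap.zero_apply, add_zero]
    exact (LinearEquiv.symm_apply_eq _).2 (by simpa using hd h (D.e A B p f))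
  · exact (LinearEquiv.symm_apply_eq _).2 (by simpa using hm h (D.e B C p f) (D.e A B q g))
  · rw [map_zero, Eps.re_zero]
  · exact congrArg Eps.re ((D'.e _ _ _).apply_symm_apply _)

end Deformation

/-! ### Linear maps over the dual numbers -/

section EpsMaps

variable {k : Type w} [CommRing k] {M N P : Type v} [AddCommGroup M] [AddCommGroup N]
  [AddCommGroup P] [Module k M] [Module k N] [Module k P]

theorem epsLin_apply (f g : M →ₗ[k] N) (x : Eps M) :
    epsLin f g x = ⟨f x.re, f x.im + g x.re⟩ := rfl

theorem epsBilin_apply (f g : M →ₗ[k] N →ₗ[k] P) (x : Eps M) (y : Eps N) :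
    epsBilin f g x y = ⟨f x.re y.re, f x.re y.im + f x.im y.re + g x.re y.re⟩ := rfl

namespace Eps

theorem eps_smul (y : M) : (DualNumber.eps : DualNumber k) • (⟨y, 0⟩ : Eps M) = ⟨0, y⟩ := by
  ext <;> simp

theorem inl_smul (r : k) (y : M) :
    (TrivSqZeroExt.inl r : DualNumber k) • (⟨y, 0⟩ : Eps M) = ⟨r • y, 0⟩ := by
  ext <;> simp

theorem eq_add_eps_smul (x : Eps M) :
    x = ⟨x.re, 0⟩ + (DualNumber.eps : DualNumber k) • (⟨x.im, 0⟩ : Eps M) := by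
  rw [eps_smul]; ext <;> simp

theorem mk_add (x y : M) : (⟨x + y, 0⟩ : Eps M) = ⟨x, 0⟩ + ⟨y, 0⟩ := by
  ext <;> simp

end Eps

/-- The coefficient of `ε` of the restriction of `L` to `M`: if `L` reduces to `f` modulo `ε`, then
`L` is the extension of `f + (imLin L)ε`. -/
def imLin (L : Eps M →ₗ[DualNumber k] Eps N) : M →ₗ[k] N where
  toFun x := (L ⟨x, 0⟩).im
  map_add' x y := by rw [Eps.mk_add, map_add, Eps.im_add]
  map_smul' r x := by simp [← Eps.inl_smul (k := k)]

theorem eq_epsLin {L : Eps M →ₗ[DualNumber k] Eps N} {f : M →ₗ[k] N}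
    (h : ∀ x, (L x).re = f x.re) : L = epsLin f (imLin L) := by
  refine LinearMap.ext fun x => Eps.ext (h x) ?_
  conv_lhs => rw [Eps.eq_add_eps_smul (k := k) x, map_add, map_smul, Eps.im_add, Eps.im_smul, h]
  simp [epsLin_apply, imLin, add_comm]

/-- The coefficient of `ε` of the restriction of `L` to `M × N`: if `L` reduces to `f` modulo `ε`,
then `L` is the extension of `f + (imBilin L)ε`. -/
def imBilin (L : Eps M →ₗ[DualNumber k] Eps N →ₗ[DualNumber k] Eps P) : M →ₗ[k] N →ₗ[k] P :=
  LinearMap.mk₂ k (fun x y => (L ⟨x, 0⟩ ⟨y, 0⟩).im)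
    (fun x x' y => by rw [Eps.mk_add, map_add, LinearMap.add_apply, Eps.im_add])
    (fun r x y => by simp [← Eps.inl_smul (k := k)])
    (fun x y y' => by rw [Eps.mk_add, map_add, Eps.im_add])
    (fun r x y => by simp [← Eps.inl_smul (k := k)])

theorem eq_epsBilin {L : Eps M →ₗ[DualNumber k] Eps N →ₗ[DualNumber k] Eps P}
    {f : M →ₗ[k] N →ₗ[k] P} (h : ∀ x y, (L x y).re = f x.re y.re) :
    L = epsBilin f (imBilin L) := by
  refine LinearMap.ext₂ fun x y => Eps.ext (h x y) ?_
  conv_lhs => rw [Eps.eq_add_eps_smul (k := k) x, Eps.eq_add_eps_smul (k := k) y]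
  simp only [map_add, map_smul, LinearMap.add_apply, LinearMap.smul_apply, Eps.im_add,
    Eps.im_smul, Eps.re_add, Eps.re_smul, h, DualNumber.fst_eps, DualNumber.snd_eps, zero_smul,
    one_smul, zero_add, add_zero, epsBilin_apply, imBilin, LinearMap.mk₂_apply]
  abel

/-- The extension of an isomorphism to `k[ε] ⊗ -`. -/
def epsEquiv (e : M ≃ₗ[k] N) : Eps M ≃ₗ[DualNumber k] Eps N where
  toFun x := ⟨e x.re, e x.im⟩
  map_add' x y := Eps.ext (map_add e _ _) (map_add e _ _)
  map_smul' r x := by ext <;> simp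
  invFun y := ⟨e.symm y.re, e.symm y.im⟩
  left_inv x := Eps.ext (e.symm_apply_apply _) (e.symm_apply_apply _)
  right_inv y := Eps.ext (e.apply_symm_apply _) (e.apply_symm_apply _)

theorem bijective_of_re {L : Eps M →ₗ[DualNumber k] Eps N} {f : M ≃ₗ[k] N}
    (h : ∀ x, (L x).re = f x.re) : Function.Bijective L := by
  rw [eq_epsLin (f := f.toLinearMap) h]
  refine ⟨fun x y hxy => ?_, fun y => ⟨⟨f.symm y.re, f.symm (y.im - imLin L (f.symm y.re))⟩, ?_⟩⟩
  · have hre : x.re = y.re := f.injective (congrArg Eps.re hxy)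
    have him : f x.im + imLin L x.re = f y.im + imLin L y.re := congrArg Eps.im hxy
    rw [hre] at him
    exact Eps.ext hre (f.injective (add_right_cancel him))
  · simp [epsLin_apply]

end EpsMaps

/-! ### Cohomologous cocycles and lifts of differentials -/

section Twist

variable {k : Type w} [CommRing k] {a : Type u} [Category.{v} a] [Preadditive a] [Linear k a]

/-- The bilinear operation `m + φε` on `k[ε] ⊗ a`. -/
def epsComp (φ : C2 k a) (A B C : a) :
    Eps (B ⟶ C) →ₗ[DualNumber k] Eps (A ⟶ B) →ₗ[DualNumber k] Eps (A ⟶ C) :=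
  epsBilin (compC2 k a A B C) (φ A B C)

theorem epsComp_apply (φ : C2 k a) {A B C : a} (y : Eps (B ⟶ C)) (x : Eps (A ⟶ B)) :
    epsComp φ A B C y x =
      ⟨x.re ≫ y.re, x.im ≫ y.re + x.re ≫ y.im + φ A B C y.re x.re⟩ := rfl

theorem defCat_comp {φ : Z2 k a} {A B C : DefCat φ} (x : A ⟶ B) (y : B ⟶ C) :
    x ≫ y = epsComp φ.1 A.base B.base C.base y x := rfl

theorem mem_Z2_of_epsComp_assoc {φ : C2 k a}
    (h : ∀ {A B C D : a} (z : Eps (C ⟶ D)) (y : Eps (B ⟶ C)) (x : Eps (A ⟶ B)),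
      epsComp φ A B D (epsComp φ B C D z y) x = epsComp φ A C D z (epsComp φ A B C y x)) :
    φ ∈ Z2 k a := by
  intro A B C D z y x
  have key := congrArg Eps.im (h ⟨z, 0⟩ ⟨y, 0⟩ ⟨x, 0⟩)
  simp only [epsComp_apply, Limits.zero_comp, Limits.comp_zero, add_zero, zero_add] at key
  rw [sub_add_eq_add_sub, key]
  abel

/-- The functor `f ↦ f + g(f)ε`, on morphisms. -/
def twist (g : C1 k a) (A B : a) : Eps (A ⟶ B) →ₗ[DualNumber k] Eps (A ⟶ B) :=
  epsLin LinearMap.id (g A B)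

theorem twist_apply (g : C1 k a) {A B : a} (x : Eps (A ⟶ B)) :
    twist g A B x = ⟨x.re, x.im + g A B x.re⟩ := rfl

theorem twist_epsComp_iff {φ φ' : C2 k a} {g : C1 k a} :
    (∀ {A B C : a} (y : Eps (B ⟶ C)) (x : Eps (A ⟶ B)), twist g A C (epsComp φ A B C y x) =
      epsComp φ' A B C (twist g B C y) (twist g A B x)) ↔ φ = φ' + d1 k a g := by
  have hd {A B C : a} (y : B ⟶ C) (x : A ⟶ B) :
      d1 k a g A B C y x = x ≫ g B C y - g A C (x ≫ y) + g A B x ≫ y := rfl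
  refine ⟨fun h => C2.ext fun A B C y x => ?_, fun h A B C y x => ?_⟩
  · have key := congrArg Eps.im (h ⟨y, 0⟩ ⟨x, 0⟩)
    simp only [twist_apply, epsComp_apply, Limits.zero_comp, Limits.comp_zero, zero_add] at key
    rw [C2.add_apply, hd, eq_sub_of_add_eq key]
    abel
  · simp only [twist_apply, epsComp_apply, h, C2.add_apply, hd, Preadditive.add_comp,
      Preadditive.comp_add]
    congr 1
    abel

theorem HH2.mk_eq_mk_iff {φ φ' : Z2 k a} :
    HH2.mk φ = HH2.mk φ' ↔ ∃ g, φ.1 = φ'.1 + d1 k a g := by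
  refine (Submodule.Quotient.eq _).trans ⟨fun ⟨g, hg⟩ => ⟨g, ?_⟩, fun ⟨g, hg⟩ => ⟨g, ?_⟩⟩
  · rw [hg]; exact (add_sub_cancel φ'.1 φ.1).symm
  · exact (sub_eq_of_eq_add' hg).symm

/-- The action of `twist` on graded morphisms. -/
def twistHom {φ φ' : Z2 k a} (g : C1 k a) {C D : Precomplex a} (γ γ' : PHom C C 1)
    (δ δ' : PHom D D 1) (n : ℤ) :
    PHom (C.lift φ γ) (D.lift φ δ) n →ₗ[DualNumber k] PHom (C.lift φ' γ') (D.lift φ' δ') n :=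
  LinearMap.pi fun t => (twist g (C.X t.p) (D.X t.q)).comp (LinearMap.proj t)

theorem twistHom_m {φ φ' : Z2 k a} {g : C1 k a} (hg : φ.1 = φ'.1 + d1 k a g)
    {C D E : Precomplex a} (γ γ' : PHom C C 1) (δ δ' : PHom D D 1) (η η' : PHom E E 1)
    {p q n : ℤ} (h : p + q = n) (f : PHom (D.lift φ δ) (E.lift φ η) p)
    (e : PHom (C.lift φ γ) (D.lift φ δ) q) :
    twistHom g γ γ' η η' n ((pcom (DualNumber k) (DefCat φ)).m h f e) =
      (pcom (DualNumber k) (DefCat φ')).m h (twistHom g δ δ' η η' p f)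
        (twistHom g γ γ' δ δ' q e) := by
  funext t
  exact (congrArg (twist g _ _) (defCat_comp _ _)).trans
    ((twist_epsComp_iff.2 hg _ _).trans (defCat_comp _ _).symm)

end Twist

section Spans

variable {T : Type u'} {k : Type w} [CommRing k] {a : Type u} [Category.{v} a] [Preadditive a]
  [Linear k a]

/-- The category spanned by the lifts `δ + δ'ε` of a family of precomplexes. -/
def spanLift (φ : Z2 k a) (o : T → Precomplex a) (δ' : ∀ t, PHom (o t) (o t) 1) :
    Deformation ((pcom k a).pull o) :=
  spanDeformation o (fun t => (o t).lift φ (δ' t)) (fun _ => rfl)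

theorem exists_eq_lift {φ : Z2 k a} {C' : Precomplex (DefCat φ)} {C : Precomplex a}
    (h : C'.red = C) : ∃ δ', C' = C.lift φ δ' := by
  subst h; exact ⟨fun t => (C'.δ t).im, rfl⟩

theorem exists_spanDeformation_eq_spanLift {φ : Z2 k a} (o : T → Precomplex a)
    (Γ : T → Precomplex (DefCat φ)) (hΓ : ∀ t, (Γ t).red = o t) :
    ∃ δ', spanDeformation o Γ hΓ = spanLift φ o δ' := by
  choose δ' h using fun t => exists_eq_lift (hΓ t)
  obtain rfl : Γ = _ := funext h
  exact ⟨δ', rfl⟩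

theorem pcom_pull_isInner {R : Type w} [CommRing R] {b : Type u} [Category.{v} b] [Preadditive b]
    [Linear R b] (o : T → Precomplex b) : ((pcom R b).pull o).IsInner fun t => (o t).δ :=
  ⟨fun _ _ => rfl, fun _ => rfl⟩

theorem spanLift_curvedIso {φ φ' : Z2 k a} (h : HH2.mk φ = HH2.mk φ') (o : T → Precomplex a)
    (δ δ' : ∀ t, PHom (o t) (o t) 1) : (spanLift φ o δ).CurvedIso (spanLift φ' o δ') := by
  obtain ⟨g, hg⟩ := HH2.mk_eq_mk_iff.1 h
  refine ⟨.ofIsInner (pcom_pull_isInner _) (pcom_pull_isInner _)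
    (fun A B n => twistHom g (δ A) (δ' A) (δ B) (δ' B) n)
    (fun hpq f e => twistHom_m hg _ _ _ _ _ _ hpq f e), fun A => ?_, fun _ => rfl⟩
  exact funext fun t => sub_self ((o A).δ t)

theorem redEquiv_c_lift (φ : Z2 k a) (C : Precomplex a) (δ' : PHom C C 1) :
    redEquiv (C.lift φ δ') (C.lift φ δ') 2 ((pcom (DualNumber k) (DefCat φ)).c (C.lift φ δ')) =
      ⟨(pcom k a).c C,
        (embr φ.1).c C + -(pcom k a).d (show (1 : ℤ) + 1 = 2 by norm_num) δ'⟩ :=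
  (redEquiv_c _).trans (Eps.ext rfl (rearrange_c _ _ _))

theorem embrDeformation_coincide (φ : Z2 k a) (o : T → Precomplex a)
    (h : ∀ t, PHom (o t) (o t) 1) : (embrDeformation φ o h).Coincide (spanLift φ o h) := by
  refine ⟨fun {A B C p q n} hpq f g => ?_, fun {A B p q} hpq f => ?_, fun A => ?_⟩
  · refine Eq.trans ?_ (redEquiv_ext2 (C := (o A).lift φ (h A)) (D := (o B).lift φ (h B))
      (E := (o C).lift φ (h C)) hpq _ _).symm
    exact LinearMap.congr_fun₂ (congrArg (epsBilin (ext2 (compC2 k a) hpq)) (add_zero _)) _ _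
  · refine Eq.symm ?_
    refine (redEquiv_d (C := (o A).lift φ (h A)) (D := (o B).lift φ (h B)) hpq _).trans ?_
    exact Eps.ext rfl (rearrange_d _ _ _ _ _ _ _)
  · exact (redEquiv_c_lift φ (o A) (h A)).symm

theorem realization_coincide (φ : Z2 k a) : (realization φ).Coincide (pcomTriv φ) := by
  have h := embrDeformation_coincide φ (id : Precomplex a → Precomplex a) fun _ => 0
  have hstr : (embrDeformation φ (id : Precomplex a → Precomplex a) fun _ => 0).str =
      (realization φ).str :=
    congrArg (Cochain2.eps (pcom k a)) (Cochain2.add_coboundaryZero_zero (pcom k a) (embr φ.1))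
  refine ⟨fun {A B C p q n} hpq f g => ?_, fun {A B p q} hpq f => ?_, fun A => ?_⟩
  · rw [← hstr]; exact h.1 hpq f g
  · rw [← hstr]; exact h.2.1 hpq f
  · rw [← hstr]; exact h.2.2 A

theorem pcomSpan_iso_realization (φ : Z2 k a)
    (Γ : ∀ C : Precomplex a, {C' : Precomplex (DefCat φ) // C'.red = C}) :
    (pcomSpan φ Γ).Iso (realization φ) := by
  obtain ⟨δ', h⟩ := exists_spanDeformation_eq_spanLift id (fun C => (Γ C).1) (fun C => (Γ C).2)
  rw [pcomSpan, h]
  exact ((spanLift_curvedIso rfl id δ' fun _ => 0).trans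
    (realization_coincide φ).symm.curvedIso).iso

end Spans

section Unobstructed

variable {k : Type w} [CommRing k] {a : Type u} [Category.{v} a] [Preadditive a] [Linear k a]

theorem mem_phiInf_iff {φ : Z2 k a} {C : ComPlus a} :
    C ∈ phiInf φ ↔ ∃ δ', (pcom (DualNumber k) (DefCat φ)).c (C.pre.lift φ δ') = 0 := by
  refine exists_congr fun δ' => ?_
  refine Iff.trans ?_ (redEquiv (C.pre.lift φ δ') (C.pre.lift φ δ') 2).map_eq_zero_iff
  refine Iff.trans ?_ (Eq.congr_left (redEquiv_c_lift φ C.pre δ')).symm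
  rw [Eps.ext_iff]
  exact ⟨fun h => ⟨pcom_c_eq_zero C.2.1, (add_neg_eq_zero).2 h.symm⟩,
    fun h => (add_neg_eq_zero.1 h.2).symm⟩

theorem phiInf_subset {φ φ' : Z2 k a} (h : HH2.mk φ = HH2.mk φ') : phiInf φ ⊆ phiInf φ' := by
  obtain ⟨g, hg⟩ := HH2.mk_eq_mk_iff.1 h
  intro C hC
  obtain ⟨δ, hδ⟩ := mem_phiInf_iff.1 hC
  let δ' : PHom C.pre C.pre 1 := fun t => δ t + g _ _ (C.pre.δ t)
  have hc : twistHom g δ δ' δ δ' 2 ((pcom (DualNumber k) (DefCat φ)).c (C.pre.lift φ δ)) =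
      (pcom (DualNumber k) (DefCat φ')).c (C.pre.lift φ' δ') :=
    (map_neg _ _).trans (congrArg Neg.neg (twistHom_m hg _ _ _ _ _ _ (by norm_num) _ _))
  exact mem_phiInf_iff.2
    ⟨δ', hc.symm.trans ((congrArg (twistHom g δ δ' δ δ' 2) hδ).trans (map_zero _))⟩

theorem phiInf_eq {φ φ' : Z2 k a} (h : HH2.mk φ = HH2.mk φ') : phiInf φ = phiInf φ' :=
  (phiInf_subset h).antisymm (phiInf_subset h.symm)

end Unobstructed

/-! ### Stalk complexes -/

section Stalks

variable {k : Type w} [CommRing k] {a : Type u} [Category.{v} a] [Preadditive a] [Linear k a]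
  {Z : a} {hZ : Limits.IsZero Z}

theorem ComPlus.exists_isZero (C : ComPlus a) : ∃ Z : a, Limits.IsZero Z := by
  obtain ⟨n, hn⟩ := C.2.2
  exact ⟨_, hn (n - 1) (by omega)⟩

theorem stalk_mem_phiInf (φ : Z2 k a) (A Z : a) (hZ : Limits.IsZero Z) :
    stalk A Z hZ ∈ phiInf φ := by
  refine ⟨0, (map_zero _).trans ?_⟩
  change (0 : PHom (stalk A Z hZ).pre (stalk A Z hZ).pre 2) =
    -ext2 φ.1 _ (0 : PHom (stalk A Z hZ).pre (stalk A Z hZ).pre 1) 0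
  rw [map_zero, neg_zero]

theorem stalk_isZero (A : a) {p : ℤ} (h : p ≠ 0) : Limits.IsZero ((stalk A Z hZ).pre.X p) := by
  change Limits.IsZero (if p = 0 then A else Z)
  rwa [if_neg h]

theorem stalk_hom_ext {A : a} {E : Precomplex a} {n : ℤ} {f g : PHom (stalk A Z hZ).pre E n}
    (h : f ⟨0, n, zero_add n⟩ = g ⟨0, n, zero_add n⟩) : f = g := by
  funext ⟨p, q, hpq⟩
  by_cases hp : p = 0
  · subst hp
    obtain rfl : n = q := by omega
    exact h
  · exact (stalk_isZero A hp).eq_of_src _ _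

theorem stalk_hom_eq_zero {A B : a} {n : ℤ} (hn : n ≠ 0)
    (f : PHom (stalk A Z hZ).pre (stalk B Z hZ).pre n) : f = 0 :=
  stalk_hom_ext ((stalk_isZero B hn).eq_of_tgt _ _)

variable (k) in
/-- Graded morphisms of degree `n` out of the stalk complex of `A` are morphisms from `A` to the
component of degree `n`. -/
def evStalk (A : a) (E : Precomplex a) (n : ℤ) :
    PHom (stalk A Z hZ).pre E n ≃ₗ[k] (A ⟶ E.X n) where
  toFun f := f ⟨0, n, zero_add n⟩
  map_add' _ _ := rfl
  map_smul' _ _ := rfl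
  invFun x t := if h : t.p = 0 then
      eqToHom (if_pos h) ≫ x ≫ eqToHom (congrArg E.X (by have := t.hpq; omega)) else 0
  left_inv f := stalk_hom_ext
    ((dif_pos rfl).trans ((Category.id_comp _).trans (Category.comp_id _)))
  right_inv x := (dif_pos rfl).trans ((Category.id_comp _).trans (Category.comp_id x))

theorem evStalk_m {A : a} {E E' : Precomplex a} {p q n : ℤ} (h : p + q = n) (f : PHom E E' p)
    (x : PHom (stalk A Z hZ).pre E q) :
    evStalk k A E' n ((pcom k a).m h f x) = evStalk k A E q x ≫ f ⟨q, n, by omega⟩ :=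
  ext2_apply (compC2 k a) h f x 0 q n _ (zero_add q) _

theorem evStalk_d {A : a} {E : Precomplex a} {p q : ℤ} (h : p + 1 = q)
    (x : PHom (stalk A Z hZ).pre E p) :
    evStalk k A E q ((pcom k a).d h x) = evStalk k A E p x ≫ E.δ ⟨p, q, h⟩ := by
  refine Eq.trans (congrArg (evStalk k A E q) ?_) (evStalk_m (by omega) E.δ x)
  change _ - p.negOnePow • (pcom k a).m h x (0 : PHom (stalk A Z hZ).pre _ 1) = _
  exact (congrArg _ ((congrArg _ (map_zero _)).trans (smul_zero _))).trans (sub_zero _)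

end Stalks

section StalkCocycle

variable {k : Type w} [CommRing k] {a : Type u} [Category.{v} a] [Preadditive a] [Linear k a]
  {Z : a} {hZ : Limits.IsZero Z} {S : Set (ComPlus a)}

/-- The object of a full subcategory given by a stalk complex. -/
def stalkIn (hS : ∀ A : a, stalk A Z hZ ∈ S) (A : a) : S := ⟨stalk A Z hZ, hS A⟩

/-- The reduction modulo `ε` of a morphism of a deformation, as a graded morphism. -/
def redHom (D : Deformation ((comPlus k a).pull (Subtype.val : S → ComPlus a))) {C E : S} {n : ℤ}
    (f : D.quiv.Hom C E n) : PHom C.1.pre E.1.pre n :=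
  (D.e C E n f).re

variable (hS : ∀ A : a, stalk A Z hZ ∈ S)
  (D D' : Deformation ((comPlus k a).pull (Subtype.val : S → ComPlus a)))

/-- The identification `D(A, C)^n ≅ k[ε] ⊗ a(A, C^n)` of the morphisms out of the stalk complex
of `A`. -/
def stalkHomEquiv (A : a) (C : S) (n : ℤ) :
    D.quiv.Hom (stalkIn hS A) C n ≃ₗ[DualNumber k] Eps (A ⟶ C.1.pre.X n) :=
  (D.e _ _ n).trans (epsEquiv (evStalk (hZ := hZ) k A C.1.pre n))

theorem stalkHomEquiv_m_re {A : a} {C E : S} {p q n : ℤ} (h : p + q = n) (f : D.quiv.Hom C E p)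
    (x : D.quiv.Hom (stalkIn hS A) C q) :
    (stalkHomEquiv hS D A E n (D.str.m h f x)).re =
      (stalkHomEquiv hS D A C q x).re ≫ redHom D f ⟨q, n, by omega⟩ :=
  (congrArg (evStalk (hZ := hZ) k A _ n) (D.red_m h f x)).trans
    (evStalk_m (hZ := hZ) h (redHom D f) _)

theorem stalkHomEquiv_d_re {A : a} {C : S} {p q : ℤ} (h : p + 1 = q)
    (x : D.quiv.Hom (stalkIn hS A) C p) :
    (stalkHomEquiv hS D A C q (D.str.d h x)).re =
      (stalkHomEquiv hS D A C p x).re ≫ C.1.pre.δ ⟨p, q, h⟩ :=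
  (congrArg (evStalk (hZ := hZ) k A _ q) (D.red_d h x)).trans (evStalk_d (hZ := hZ) h _)

theorem stalkIn_hom_eq_zero {A B : a} {n : ℤ} (hn : n ≠ 0)
    (f : D.quiv.Hom (stalkIn hS A) (stalkIn hS B) n) : f = 0 :=
  (D.e _ _ n).map_eq_zero_iff.1
    (Eps.ext (stalk_hom_eq_zero (hZ := hZ) hn _) (stalk_hom_eq_zero (hZ := hZ) hn _))

/-- The identification `D(A, B)⁰ ≅ k[ε] ⊗ a(A, B)` for the stalk complexes of `A` and `B`. -/
def stalkEquiv (A B : a) :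
    D.quiv.Hom (stalkIn hS A) (stalkIn hS B) 0 ≃ₗ[DualNumber k] Eps (A ⟶ B) :=
  stalkHomEquiv hS D A (stalkIn hS B) 0

/-- The composition of the deformation `D` on stalk complexes, transported to `k[ε] ⊗ a`. -/
def stalkComp (A B C : a) :
    Eps (B ⟶ C) →ₗ[DualNumber k] Eps (A ⟶ B) →ₗ[DualNumber k] Eps (A ⟶ C) :=
  ((D.str.m (add_zero 0)).compl₁₂ (stalkEquiv hS D B C).symm.toLinearMap
    (stalkEquiv hS D A B).symm.toLinearMap).compr₂ (stalkEquiv hS D A C).toLinearMap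

theorem stalkComp_stalkEquiv {A B C : a} (y : D.quiv.Hom (stalkIn hS B) (stalkIn hS C) 0)
    (x : D.quiv.Hom (stalkIn hS A) (stalkIn hS B) 0) :
    stalkComp hS D A B C (stalkEquiv hS D B C y) (stalkEquiv hS D A B x) =
      stalkEquiv hS D A C (D.str.m (add_zero 0) y x) := by
  simp [stalkComp]

theorem stalkComp_assoc {A B C E : a} (z : Eps (C ⟶ E)) (y : Eps (B ⟶ C)) (x : Eps (A ⟶ B)) :
    stalkComp hS D A B E (stalkComp hS D B C E z y) x =
      stalkComp hS D A C E z (stalkComp hS D A B C y x) := by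
  obtain ⟨z, rfl⟩ := (stalkEquiv hS D C E).surjective z
  obtain ⟨y, rfl⟩ := (stalkEquiv hS D B C).surjective y
  obtain ⟨x, rfl⟩ := (stalkEquiv hS D A B).surjective x
  simp only [stalkComp_stalkEquiv]
  rw [D.isCDG.assoc (add_zero 0) (add_zero 0) (add_zero (0 + 0)) z y x]

/-- The coefficient of `ε` of the composition of the deformation `D` on stalk complexes, a
Hochschild 2-cochain of `a`. -/
def stalkCochain : C2 k a := fun A B C => imBilin (stalkComp hS D A B C)

theorem stalkComp_eq_epsComp (A B C : a) :
    stalkComp hS D A B C = epsComp (stalkCochain hS D) A B C :=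
  eq_epsBilin (f := compC2 k a A B C) fun y x => by
    obtain ⟨y, rfl⟩ := (stalkEquiv hS D B C).surjective y
    obtain ⟨x, rfl⟩ := (stalkEquiv hS D A B).surjective x
    rw [stalkComp_stalkEquiv]
    exact stalkHomEquiv_m_re hS D (add_zero 0) y x

/-- The Hochschild cocycle `φ` for which the deformation `D` restricts to `a_φ[ε]` on the stalk
complexes. -/
def stalkCocycle : Z2 k a :=
  ⟨stalkCochain hS D, mem_Z2_of_epsComp_assoc fun {_ _ _ _} z y x => by
    rw [← stalkComp_eq_epsComp, ← stalkComp_eq_epsComp, ← stalkComp_eq_epsComp,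
      ← stalkComp_eq_epsComp, stalkComp_assoc]⟩

theorem stalkEquiv_m {A B C : a} (y : D.quiv.Hom (stalkIn hS B) (stalkIn hS C) 0)
    (x : D.quiv.Hom (stalkIn hS A) (stalkIn hS B) 0) :
    stalkEquiv hS D A C (D.str.m (add_zero 0) y x) =
      epsComp (stalkCocycle hS D).1 A B C (stalkEquiv hS D B C y) (stalkEquiv hS D A B x) := by
  rw [← stalkComp_stalkEquiv, stalkComp_eq_epsComp]
  rfl

theorem stalkCocycle_spanLift (φ : Z2 k a) (δ : ∀ C : S, PHom C.1.pre C.1.pre 1) :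
    stalkCocycle hS (spanLift φ (fun C : S => C.1.pre) δ) = φ := by
  let D := spanLift φ (fun C : S => C.1.pre) δ
  have h (A B C : a) : stalkComp hS D A B C = epsComp φ.1 A B C := by
    refine LinearMap.ext₂ fun y x => ?_
    obtain ⟨y, rfl⟩ := (stalkEquiv hS D B C).surjective y
    obtain ⟨x, rfl⟩ := (stalkEquiv hS D A B).surjective x
    exact stalkComp_stalkEquiv hS D y x
  refine Subtype.ext (C2.ext fun A B C y x => ?_)
  refine (congrArg (fun L => (L ⟨y, 0⟩ ⟨x, 0⟩).im) (h A B C)).trans ?_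
  simp [epsComp_apply]

variable {D D'}

theorem AMor.linear_m_stalkIn (F : AMor D.str D'.str) {A B C : a}
    (y : D.quiv.Hom (stalkIn hS B) (stalkIn hS C) 0)
    (x : D.quiv.Hom (stalkIn hS A) (stalkIn hS B) 0) :
    F.linear _ _ 0 (D.str.m (add_zero 0) y x) =
      D'.str.m (add_zero 0) (F.linear _ _ 0 y) (F.linear _ _ 0 x) := by
  have hc (A : a) : D.str.c (stalkIn hS A) = 0 := stalkIn_hom_eq_zero hS D two_ne_zero _
  have hd {A B : a} (x : D.quiv.Hom (stalkIn hS A) (stalkIn hS B) 0) : D.str.d rfl x = 0 :=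
    stalkIn_hom_eq_zero hS D (by norm_num) _
  refine F.linear_m _ y x (hc A) (hc B) (hc C) (hd y) (hd x) fun e => ?_
  by_cases he : e = 0
  · exact F.F_deg _ _ (by simp [he, Path.sdeg])
  · exact stalkIn_hom_eq_zero hS D' he _

theorem Deformation.Iso.mk_stalkCocycle_eq (h : D.Iso D') :
    HH2.mk (stalkCocycle hS D) = HH2.mk (stalkCocycle hS D') := by
  obtain ⟨F, -, h₁, -⟩ := h
  let L (A B : a) : Eps (A ⟶ B) →ₗ[DualNumber k] Eps (A ⟶ B) :=
    (stalkEquiv hS D' A B).toLinearMap ∘ₗ F.linear _ _ 0 ∘ₗ (stalkEquiv hS D A B).symm.toLinearMap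
  have hL {A B : a} (x : D.quiv.Hom (stalkIn hS A) (stalkIn hS B) 0) :
      L A B (stalkEquiv hS D A B x) = stalkEquiv hS D' A B (F.linear _ _ 0 x) := by simp [L]
  have hLg (A B : a) : L A B = twist (fun A B => imLin (L A B)) A B := by
    refine eq_epsLin (f := LinearMap.id) fun x => ?_
    obtain ⟨x, rfl⟩ := (stalkEquiv hS D A B).surjective x
    rw [hL]
    exact congrArg (evStalk (hZ := hZ) k A _ 0) (h₁ x)
  refine HH2.mk_eq_mk_iff.2 ⟨fun A B => imLin (L A B), twist_epsComp_iff.1 fun {A B C} y x => ?_⟩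
  obtain ⟨y, rfl⟩ := (stalkEquiv hS D B C).surjective y
  obtain ⟨x, rfl⟩ := (stalkEquiv hS D A B).surjective x
  rw [← hLg, ← hLg, ← hLg, ← stalkEquiv_m, hL, hL, hL, ← stalkEquiv_m, F.linear_m_stalkIn]

theorem Deformation.Iso.mk_stalkCocycle_eq_of_spanLift {φ : Z2 k a}
    {δ : ∀ C : S, PHom C.1.pre C.1.pre 1} (h : D.Iso (spanLift φ (fun C : S => C.1.pre) δ)) :
    HH2.mk (stalkCocycle hS D) = HH2.mk φ :=
  (h.mk_stalkCocycle_eq hS).trans (congrArg HH2.mk (stalkCocycle_spanLift hS φ δ))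

end StalkCocycle

/-! ### Reconstruction from the stalk complexes -/

section Reconstruction

variable {k : Type w} [CommRing k] {a : Type u} [Category.{v} a] [Preadditive a] [Linear k a]
  {Z : a} {hZ : Limits.IsZero Z} {S : Set (ComPlus a)} (hS : ∀ A : a, stalk A Z hZ ∈ S)
  (D : Deformation ((comPlus k a).pull (Subtype.val : S → ComPlus a)))

/-- The inclusion of the stalk complex of `C^p` in `C`, as a morphism of degree `p` of the
deformation `D`. -/
def stalkIncl (C : S) (p : ℤ) : D.quiv.Hom (stalkIn hS (C.1.pre.X p)) C p :=
  (stalkHomEquiv hS D _ C p).symm ⟨𝟙 _, 0⟩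

theorem stalkHomEquiv_stalkIncl (C : S) (p : ℤ) :
    stalkHomEquiv hS D _ C p (stalkIncl hS D C p) = ⟨𝟙 _, 0⟩ :=
  LinearEquiv.apply_symm_apply _ _

/-- Composition of morphisms `A → C^p` with the inclusion of the stalk complex of `C^p` in `C`. -/
def inclMap (A : a) (C : S) (p : ℤ) :
    Eps (A ⟶ C.1.pre.X p) →ₗ[DualNumber k] D.quiv.Hom (stalkIn hS A) C p :=
  D.str.m (add_zero p) (stalkIncl hS D C p) ∘ₗ (stalkEquiv hS D A (C.1.pre.X p)).symm.toLinearMap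

theorem stalkHomEquiv_inclMap_re {A : a} {C : S} {p : ℤ} (x : Eps (A ⟶ C.1.pre.X p)) :
    (stalkHomEquiv hS D A C p (inclMap hS D A C p x)).re = x.re := by
  have hx : (stalkHomEquiv hS D A _ 0 ((stalkEquiv hS D A (C.1.pre.X p)).symm x)).re = x.re :=
    congrArg Eps.re ((stalkEquiv hS D A (C.1.pre.X p)).apply_symm_apply x)
  have hι := congrArg Eps.re (stalkHomEquiv_stalkIncl hS D C p)
  refine (stalkHomEquiv_m_re hS D (add_zero p) _ _).trans ?_
  exact (congrArg₂ _ hx hι).trans (Category.comp_id _)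

/-- Every morphism of `D` from the stalk complex of `A` to `C` factors uniquely through the
inclusion of the stalk complex of `C^p` in `C`. -/
noncomputable def inclEquiv (A : a) (C : S) (p : ℤ) :
    Eps (A ⟶ C.1.pre.X p) ≃ₗ[DualNumber k] D.quiv.Hom (stalkIn hS A) C p :=
  LinearEquiv.ofBijective (inclMap hS D A C p) <|
    ((stalkHomEquiv hS D A C p).bijective.of_comp_iff' _).1 <|
      bijective_of_re (L := (stalkHomEquiv hS D A C p).toLinearMap ∘ₗ inclMap hS D A C p)
        (f := LinearEquiv.refl k _) fun x => stalkHomEquiv_inclMap_re hS D x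

theorem inclEquiv_apply {A : a} {C : S} {p : ℤ} (x : Eps (A ⟶ C.1.pre.X p)) :
    inclEquiv hS D A C p x =
      D.str.m (add_zero p) (stalkIncl hS D C p) ((stalkEquiv hS D A (C.1.pre.X p)).symm x) := rfl

theorem inclEquiv_symm_re {A : a} {C : S} {p : ℤ} (x : D.quiv.Hom (stalkIn hS A) C p) :
    ((inclEquiv hS D A C p).symm x).re = (stalkHomEquiv hS D A C p x).re := by
  obtain ⟨x, rfl⟩ := (inclEquiv hS D A C p).surjective x
  rw [LinearEquiv.symm_apply_apply]
  exact (stalkHomEquiv_inclMap_re hS D x).symm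

theorem m_inclEquiv_stalkEquiv_symm {A B : a} {C : S} {p : ℤ} (y : Eps (B ⟶ C.1.pre.X p))
    (x : Eps (A ⟶ B)) :
    D.str.m (add_zero p) (inclEquiv hS D B C p y) ((stalkEquiv hS D A B).symm x) =
      inclEquiv hS D A C p (stalkComp hS D A B _ y x) := by
  rw [inclEquiv_apply, inclEquiv_apply, D.isCDG.assoc (add_zero p) (add_zero 0) (by omega)]
  congr 1
  rw [LinearEquiv.eq_symm_apply, ← stalkComp_stalkEquiv, LinearEquiv.apply_symm_apply,
    LinearEquiv.apply_symm_apply]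

/-- The component `C^p → E^q` over `a_φ[ε]` of a morphism of `D`, where `φ` is the cocycle of `D`:
it represents the composition with the inclusion of the stalk complex of `C^p` in `C`. -/
noncomputable def homCoeff {C E : S} {p q n : ℤ} (h : p + n = q) :
    D.quiv.Hom C E n →ₗ[DualNumber k] Eps (C.1.pre.X p ⟶ E.1.pre.X q) :=
  (inclEquiv hS D (C.1.pre.X p) E q).symm.toLinearMap ∘ₗ
    (D.str.m (show n + p = q by omega)).flip (stalkIncl hS D C p)

/-- The component `C^p → C^q` over `a_φ[ε]` of the differential of `C`: it represents the
differential in `D` of the inclusion of the stalk complex of `C^p` in `C`. -/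
noncomputable def diffCoeff (C : S) {p q : ℤ} (h : p + 1 = q) :
    Eps (C.1.pre.X p ⟶ C.1.pre.X q) :=
  (inclEquiv hS D (C.1.pre.X p) C q).symm (D.str.d h (stalkIncl hS D C p))

theorem homCoeff_re {C E : S} {n : ℤ} (f : D.quiv.Hom C E n) (t : Triplet n) :
    (homCoeff hS D t.hpq f).re = redHom D f t := by
  refine (inclEquiv_symm_re hS D _).trans ((stalkHomEquiv_m_re hS D _ f _).trans ?_)
  rw [stalkHomEquiv_stalkIncl]
  exact Category.id_comp _

theorem diffCoeff_re (C : S) (t : Triplet 1) : (diffCoeff hS D C t.hpq).re = C.1.pre.δ t := by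
  refine (inclEquiv_symm_re hS D _).trans ((stalkHomEquiv_d_re hS D t.hpq _).trans ?_)
  rw [stalkHomEquiv_stalkIncl]
  exact Category.id_comp _

theorem inclEquiv_homCoeff {C E : S} {p q n : ℤ} (h : p + n = q) (f : D.quiv.Hom C E n) :
    inclEquiv hS D _ E q (homCoeff hS D h f) =
      D.str.m (show n + p = q by omega) f (stalkIncl hS D C p) :=
  (inclEquiv hS D _ E q).apply_symm_apply _

theorem inclEquiv_diffCoeff (C : S) {p q : ℤ} (h : p + 1 = q) :
    inclEquiv hS D _ C q (diffCoeff hS D C h) = D.str.d h (stalkIncl hS D C p) :=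
  (inclEquiv hS D _ C q).apply_symm_apply _

theorem m_inclEquiv {A : a} {C E : S} {p q n : ℤ} (h : n + p = q) (f : D.quiv.Hom C E n)
    (x : Eps (A ⟶ C.1.pre.X p)) :
    D.str.m h f (inclEquiv hS D A C p x) =
      inclEquiv hS D A E q
        (stalkComp hS D _ _ _ (homCoeff hS D (show p + n = q by omega) f) x) := by
  rw [inclEquiv_apply, ← D.isCDG.assoc h (add_zero p) (by omega), ← m_inclEquiv_stalkEquiv_symm,
    inclEquiv_homCoeff]

theorem d_inclEquiv {A : a} {C : S} {p q : ℤ} (h : p + 1 = q) (x : Eps (A ⟶ C.1.pre.X p)) :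
    D.str.d h (inclEquiv hS D A C p x) =
      inclEquiv hS D A C q (stalkComp hS D _ _ _ (diffCoeff hS D C h) x) := by
  rw [inclEquiv_apply, D.isCDG.leibniz (add_zero p) h (zero_add 1) h,
    stalkIn_hom_eq_zero hS D one_ne_zero (D.str.d _ _), map_zero, smul_zero, add_zero,
    ← m_inclEquiv_stalkEquiv_symm, inclEquiv_diffCoeff]

theorem homCoeff_m {B C E : S} {p q n i l j : ℤ} (h : p + q = n) (hij : i + n = j)
    (hil : i + q = l) (hlj : l + p = j) (f : D.quiv.Hom C E p) (g : D.quiv.Hom B C q) :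
    homCoeff hS D hij (D.str.m h f g) =
      stalkComp hS D _ _ _ (homCoeff hS D hlj f) (homCoeff hS D hil g) := by
  apply (inclEquiv hS D _ E j).injective
  rw [inclEquiv_homCoeff, D.isCDG.assoc h (show q + i = l by omega) (by omega),
    ← m_inclEquiv hS D (show p + l = j by omega), inclEquiv_homCoeff]

theorem homCoeff_d {C E : S} {p q i l l' j : ℤ} (h : p + 1 = q) (hij : i + q = j)
    (hil : i + p = l) (hlj : l + 1 = j) (hil' : i + 1 = l') (hlj' : l' + p = j)
    (f : D.quiv.Hom C E p) :
    homCoeff hS D hij (D.str.d h f) =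
      stalkComp hS D _ _ _ (diffCoeff hS D E hlj) (homCoeff hS D hil f) -
        p.negOnePow • stalkComp hS D _ _ _ (homCoeff hS D hlj' f) (diffCoeff hS D C hil') := by
  apply (inclEquiv hS D _ E j).injective
  have := D.isCDG.leibniz (show p + i = l by omega) h hil' hlj f (stalkIncl hS D C i)
  rw [← inclEquiv_homCoeff hS D hil, ← inclEquiv_diffCoeff, d_inclEquiv, m_inclEquiv,
    ← inclEquiv_homCoeff hS D hij] at this
  rw [Units.smul_def, map_sub, map_zsmul, ← Units.smul_def, this, add_sub_cancel_right]

theorem homCoeff_c (C : S) {i l j : ℤ} (hij : i + 2 = j) (hil : i + 1 = l) (hlj : l + 1 = j) :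
    homCoeff hS D hij (D.str.c C) =
      -stalkComp hS D _ _ _ (diffCoeff hS D C hlj) (diffCoeff hS D C hil) := by
  apply (inclEquiv hS D _ C j).injective
  have := D.isCDG.d_d hil hlj (stalkIncl hS D C i)
  rw [stalkIn_hom_eq_zero hS D two_ne_zero (D.str.c (stalkIn hS _)), map_zero, sub_zero,
    ← inclEquiv_diffCoeff, d_inclEquiv, ← inclEquiv_homCoeff hS D hij] at this
  rw [map_neg, this, neg_neg]

/-- The coefficient of `ε` of the differential over `a_φ[ε]` that `D` determines on `C`. -/
noncomputable def diffCoeffIm (C : S) : PHom C.1.pre C.1.pre 1 :=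
  fun t => (diffCoeff hS D C t.hpq).im

/-- The precomplex over `a_φ[ε]` that reconstructs the object `C` of `D`. -/
noncomputable def reconstruct (C : S) : Precomplex (DefCat (stalkCocycle hS D)) :=
  C.1.pre.lift (stalkCocycle hS D) (diffCoeffIm hS D C)

theorem reconstruct_δ (C : S) {p q : ℤ} (h : p + 1 = q) :
    (reconstruct hS D C).δ ⟨p, q, h⟩ = diffCoeff hS D C h :=
  Eps.ext (diffCoeff_re hS D C ⟨p, q, h⟩).symm rfl

/-- The graded morphism over `a_φ[ε]` that reconstructs a morphism of `D`. -/
noncomputable def reconstructHom (C E : S) (n : ℤ) :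
    D.quiv.Hom C E n →ₗ[DualNumber k] PHom (reconstruct hS D C) (reconstruct hS D E) n :=
  LinearMap.pi fun t => homCoeff hS D t.hpq

theorem reconstructHom_m {B C E : S} {p q n : ℤ} (h : p + q = n) (f : D.quiv.Hom C E p)
    (g : D.quiv.Hom B C q) :
    reconstructHom hS D B E n (D.str.m h f g) = (pcom (DualNumber k) (DefCat _)).m h
      (reconstructHom hS D C E p f) (reconstructHom hS D B C q g) := by
  funext ⟨i, j, hij⟩
  refine (homCoeff_m hS D h hij rfl (by omega) f g).trans ?_
  rw [stalkComp_eq_epsComp]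
  rfl

theorem reconstructHom_d {C E : S} {p q : ℤ} (h : p + 1 = q) (f : D.quiv.Hom C E p) :
    reconstructHom hS D C E q (D.str.d h f) =
      (pcom (DualNumber k) (DefCat _)).d h (reconstructHom hS D C E p f) := by
  funext ⟨i, j, hij⟩
  refine (homCoeff_d hS D h hij rfl (show i + p + 1 = j by omega) rfl (by omega) f).trans ?_
  rw [stalkComp_eq_epsComp, stalkComp_eq_epsComp, ← reconstruct_δ, ← reconstruct_δ]
  rfl

theorem reconstructHom_c (C : S) :
    reconstructHom hS D C C 2 (D.str.c C) =
      (pcom (DualNumber k) (DefCat _)).c (reconstruct hS D C) := by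
  funext ⟨i, j, hij⟩
  refine (homCoeff_c hS D C hij rfl (by omega)).trans ?_
  rw [stalkComp_eq_epsComp, ← reconstruct_δ, ← reconstruct_δ]
  rfl

theorem curvedIso_spanLift_stalkCocycle : D.CurvedIso
    (spanLift (stalkCocycle hS D) (fun C : S => C.1.pre) (diffCoeffIm hS D)) := by
  refine ⟨⟨fun _ => 0, reconstructHom hS D, fun A => ?_, fun h f => ?_,
    fun h f g => reconstructHom_m hS D h f g⟩, fun A => ?_, fun f => ?_⟩
  · rw [map_zero, map_zero, sub_zero, sub_zero]
    exact (reconstructHom_c hS D A).symm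
  · rw [map_zero, map_zero, smul_zero, sub_zero, LinearMap.zero_apply, add_zero]
    exact reconstructHom_d hS D h f
  · rw [map_zero, Eps.re_zero]
  · exact funext fun t => homCoeff_re hS D f t

variable {D} in
theorem subset_phiInf_stalkCocycle (hD : D.IsDG) : S ⊆ phiInf (stalkCocycle hS D) := by
  intro C hC
  refine mem_phiInf_iff.2 ⟨diffCoeffIm hS D ⟨C, hC⟩, ?_⟩
  exact (reconstructHom_c hS D ⟨C, hC⟩).symm.trans ((congrArg _ (hD _)).trans (map_zero _))

end Reconstruction

/-! ### Maximal partial deformations -/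

section Classification

variable {k : Type w} [CommRing k] {a : Type u} [Category.{v} a] [Preadditive a] [Linear k a]

theorem curvedIso_restrict_embrPartial {φ φ' : Z2 k a} (hφ : HH2.mk φ = HH2.mk φ')
    {S : Set (ComPlus a)} {D : Deformation ((comPlus k a).pull (Subtype.val : S → ComPlus a))}
    {δ : ∀ C : S, PHom C.1.pre C.1.pre 1}
    (hD : D.CurvedIso (spanLift φ (fun C : S => C.1.pre) δ))
    (h : ∀ C : phiInf φ', PHom C.1.pre C.1.pre 1)
    (hh : ∀ C : phiInf φ',
      (pcom k a).d (show (1 : ℤ) + 1 = 2 by norm_num) (h C) = (embr φ'.1).c C.1.pre)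
    (hS : S ⊆ phiInf φ') : D.CurvedIso ((embrPartial φ' h hh).restrict hS) :=
  (hD.trans (spanLift_curvedIso hφ _ δ fun C => h (Set.inclusion hS C))).trans
    (embrDeformation_coincide φ' _ _).symm.curvedIso

theorem isMaximal_of_iso_spanLift {φ : Z2 k a} {P : PartialDG (comPlus k a)} (hP : P.S = phiInf φ)
    {δ : ∀ C : P.S, PHom C.1.pre C.1.pre 1}
    (h : P.D.Iso (spanLift φ (fun C : P.S => C.1.pre) δ)) : P.IsMaximal := by
  rintro P' ⟨hsub, hiso⟩
  refine Set.Subset.antisymm (fun C hC => ?_) hsub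
  obtain ⟨Z, hZ⟩ := C.exists_isZero
  have hS (A : a) : stalk A Z hZ ∈ P.S := hP ▸ stalk_mem_phiInf φ A Z hZ
  have hS' (A : a) : stalk A Z hZ ∈ P'.S := hsub (hS A)
  have hφ : HH2.mk (stalkCocycle hS' P'.D) = HH2.mk φ :=
    (Deformation.Iso.mk_stalkCocycle_eq hS hiso).symm.trans
      (Deformation.Iso.mk_stalkCocycle_eq_of_spanLift hS h)
  rw [hP]
  exact phiInf_subset hφ (subset_phiInf_stalkCocycle hS' P'.isDG hC)

theorem embrPartial_isMaximal (φ : Z2 k a) (h : ∀ C : phiInf φ, PHom C.1.pre C.1.pre 1)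
    (hh : ∀ C : phiInf φ,
      (pcom k a).d (show (1 : ℤ) + 1 = 2 by norm_num) (h C) = (embr φ.1).c C.1.pre) :
    (embrPartial φ h hh).IsMaximal :=
  isMaximal_of_iso_spanLift rfl (embrDeformation_coincide φ _ h).curvedIso.iso

theorem exists_comSpan_curvedIso_spanLift (φ : Z2 k a)
    (Γ : ∀ C : phiInf φ, {C' : Precomplex (DefCat φ) // C'.red = C.1.pre ∧ C'.IsComplex}) :
    ∃ δ, (comSpan φ Γ).D.CurvedIso (spanLift φ (fun C : phiInf φ => C.1.pre) δ) := by
  obtain ⟨δ, hδ⟩ := exists_spanDeformation_eq_spanLift (fun C : phiInf φ => C.1.pre)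
    (fun C => (Γ C).1) fun C => (Γ C).2.1
  refine ⟨δ, ?_⟩
  rw [← hδ]
  exact (Deformation.Coincide.refl _).curvedIso

theorem comSpan_isMaximal (φ : Z2 k a)
    (Γ : ∀ C : phiInf φ, {C' : Precomplex (DefCat φ) // C'.red = C.1.pre ∧ C'.IsComplex}) :
    (comSpan φ Γ).IsMaximal := by
  obtain ⟨_, h⟩ := exists_comSpan_curvedIso_spanLift φ Γ
  exact isMaximal_of_iso_spanLift rfl h.iso

theorem HH2.mk_out (x : HH2 k a) : HH2.mk (Quotient.out x) = x :=
  Quotient.out_eq x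

/-- The partial dg deformation given by chosen representatives, whose class is `ρ'(x)`. -/
noncomputable def classPartial (x : HH2 k a) : PartialDG (comPlus k a) :=
  embrPartial (Quotient.out x) (fun C => Classical.choose C.2) fun C => Classical.choose_spec C.2

theorem iso_restrict_classPartial {φ : Z2 k a} {S : Set (ComPlus a)}
    {D : Deformation ((comPlus k a).pull (Subtype.val : S → ComPlus a))}
    {δ : ∀ C : S, PHom C.1.pre C.1.pre 1}
    (hD : D.CurvedIso (spanLift φ (fun C : S => C.1.pre) δ))
    (hS : S ⊆ (classPartial (HH2.mk φ)).S) : D.Iso ((classPartial (HH2.mk φ)).restrict hS) :=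
  (curvedIso_restrict_embrPartial (HH2.mk_out _).symm hD _ _ hS).iso

theorem phiInf_eq_classPartial (φ : Z2 k a) : phiInf φ = (classPartial (HH2.mk φ)).S :=
  phiInf_eq (HH2.mk_out _).symm

theorem mk_comSpan (φ : Z2 k a)
    (Γ : ∀ C : phiInf φ, {C' : Precomplex (DefCat φ) // C'.red = C.1.pre ∧ C'.IsComplex}) :
    PartialDG.Sk.mk (comSpan φ Γ) = rhoPrime (HH2.mk φ) := by
  obtain ⟨_, h⟩ := exists_comSpan_curvedIso_spanLift φ Γ
  exact Quot.sound ⟨phiInf_eq_classPartial φ, iso_restrict_classPartial h _⟩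

/-- The map `ρ`: the class of a Hochschild cohomology class among the maximal partial dg
deformations. -/
noncomputable def rho (x : HH2 k a) : PartialDG.SkMax (comPlus k a) :=
  PartialDG.SkMax.mk (classPartial x) (embrPartial_isMaximal _ _ _)

/-- The cohomology class of the restriction of a partial dg deformation to the stalk complexes,
defined if these are among its objects. -/
def stalkClass (Z : a) (hZ : Limits.IsZero Z) (P : PartialDG (comPlus k a)) : Part (HH2 k a) :=
  ⟨∀ A : a, stalk A Z hZ ∈ P.S, fun hS => HH2.mk (stalkCocycle hS P.D)⟩

theorem stalkClass_eq_of_iso {Z : a} {hZ : Limits.IsZero Z} {P P' : PartialDG (comPlus k a)}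
    (h : P.Iso P') : stalkClass Z hZ P = stalkClass Z hZ P' := by
  obtain ⟨hPP', hiso⟩ := h
  refine Part.ext' (forall_congr' fun A => Set.ext_iff.1 hPP' _) fun hS _ => ?_
  exact Deformation.Iso.mk_stalkCocycle_eq (D' := P'.restrict hPP'.subset) hS hiso

theorem stalkClass_classPartial (Z : a) (hZ : Limits.IsZero Z) (x : HH2 k a) :
    stalkClass Z hZ (classPartial x) = Part.some x := by
  have hS (A : a) : stalk A Z hZ ∈ phiInf (Quotient.out x) := stalk_mem_phiInf _ A Z hZ
  exact Part.eq_some_iff.2 ⟨hS, (Deformation.Iso.mk_stalkCocycle_eq_of_spanLift hS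
    (embrDeformation_coincide _ _ _).curvedIso.iso).trans (HH2.mk_out x)⟩

theorem rho_injective (Z : a) (hZ : Limits.IsZero Z) :
    Function.Injective (rho (k := k) (a := a)) := by
  let c : PartialDG.SkMax (comPlus k a) → Part (HH2 k a) :=
    Quot.lift (fun P => stalkClass Z hZ P.1) fun _ _ => stalkClass_eq_of_iso
  have hc (x : HH2 k a) : c (rho x) = Part.some x := stalkClass_classPartial Z hZ x
  intro x y hxy
  exact Part.some_injective ((hc x).symm.trans ((congrArg c hxy).trans (hc y)))

theorem exists_hasMor_classPartial {Z : a} {hZ : Limits.IsZero Z}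
    {P : PartialDG (comPlus k a)} (hS : ∀ A : a, stalk A Z hZ ∈ P.S) :
    ∃ x, P.HasMor (classPartial x) :=
  have hsub := (subset_phiInf_stalkCocycle hS P.isDG).trans (phiInf_eq_classPartial _).subset
  ⟨_, hsub, iso_restrict_classPartial (curvedIso_spanLift_stalkCocycle hS P.D) hsub⟩

theorem range_rho (Z : a) (hZ : Limits.IsZero Z) :
    Set.range (rho (k := k) (a := a)) = {ξ | ∃ (P : PartialDG (comPlus k a)) (hP : P.IsMaximal),
      (∀ A : a, stalk A Z hZ ∈ P.S) ∧ PartialDG.SkMax.mk P hP = ξ} := by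
  refine Set.Subset.antisymm ?_ ?_
  · rintro _ ⟨x, rfl⟩
    exact ⟨classPartial x, _, fun A => stalk_mem_phiInf _ A Z hZ, rfl⟩
  · rintro _ ⟨P, hP, hS, rfl⟩
    obtain ⟨x, hsub, hiso⟩ := exists_hasMor_classPartial hS
    have hPS : (classPartial x).S = P.S := hP _ ⟨hsub, hiso⟩
    exact ⟨x, Eq.symm (Quot.sound ⟨hPS.symm, hiso⟩)⟩

end Classification

end LowenDef

theorem mainTheorem6_general {k : Type w} [CommRing k] {a : Type u} [Category.{v} a] [Preadditive a]
    [Linear k a] :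
    (∀ φ : Z2 k a,
      ((realization φ).Coincide (pcomTriv φ) ∧ (realization φ).Iso (pcomTriv φ)) ∧
      (∀ Γ : ∀ C : Precomplex a, {C' : Precomplex (DefCat φ) // C'.red = C},
        (pcomSpan φ Γ).Iso (realization φ)) ∧
      (∀ Γ : ∀ C : phiInf φ,
          {C' : Precomplex (DefCat φ) // C'.red = C.1.pre ∧ C'.IsComplex},
        (comSpan φ Γ).IsMaximal ∧ PartialDG.Sk.mk (comSpan φ Γ) = rhoPrime (HH2.mk φ))) ∧
    ∃ ρ : HH2 k a → PartialDG.SkMax (comPlus k a),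
      (∀ x : HH2 k a, (ρ x).forget = rhoPrime x) ∧
      ∀ (Z : a) (hZ : Limits.IsZero Z),
        Function.Injective ρ ∧
        Set.range ρ = {ξ | ∃ (P : PartialDG (comPlus k a)) (hP : P.IsMaximal),
          (∀ A : a, stalk A Z hZ ∈ P.S) ∧ PartialDG.SkMax.mk P hP = ξ} :=
  ⟨fun φ => ⟨⟨realization_coincide φ, (realization_coincide φ).curvedIso.iso⟩,
    pcomSpan_iso_realization φ, fun Γ => ⟨comSpan_isMaximal φ Γ, mk_comSpan φ Γ⟩⟩,
    rho, fun _ => rfl, fun Z hZ => ⟨rho_injective Z hZ, range_rho Z hZ⟩⟩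

theorem mainTheorem6 {k : Type w} [Field k] {a : Type u} [Category.{v} a] [Preadditive a]
    [Linear k a] :
    (∀ φ : Z2 k a,
      ((realization φ).Coincide (pcomTriv φ) ∧ (realization φ).Iso (pcomTriv φ)) ∧
      (∀ Γ : ∀ C : Precomplex a, {C' : Precomplex (DefCat φ) // C'.red = C},
        (pcomSpan φ Γ).Iso (realization φ)) ∧
      (∀ Γ : ∀ C : phiInf φ,
          {C' : Precomplex (DefCat φ) // C'.red = C.1.pre ∧ C'.IsComplex},
        (comSpan φ Γ).IsMaximal ∧ PartialDG.Sk.mk (comSpan φ Γ) = rhoPrime (HH2.mk φ))) ∧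
    ∃ ρ : HH2 k a → PartialDG.SkMax (comPlus k a),
      (∀ x : HH2 k a, (ρ x).forget = rhoPrime x) ∧
      ∀ (Z : a) (hZ : Limits.IsZero Z),
        Function.Injective ρ ∧
        Set.range ρ = {ξ | ∃ (P : PartialDG (comPlus k a)) (hP : P.IsMaximal),
          (∀ A : a, stalk A Z hZ ∈ P.S) ∧ PartialDG.SkMax.mk P hP = ξ} :=
  mainTheorem6_general
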